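/- Let $F=\mathrm{GF}(q)$ with a fixed numbering $\rho:F\to\{0,\dots,q-1\}$ of its elements, $\alpha_d=\rho^{-1}(d)$, and let $\binom{n}{k}_q=\prod_{i=0}^{k-1}\frac{q^{n-i}-1}{q^{i+1}-1}$. For a matrix or a subspace let $\Lambda(\cdot)$ be the set of columns holding the leading coefficients of its row echelon form; vectors of length $n$ are indexed by $0,\dots,n-1$. **Encoding function.** $\mathcal E_{n,k}$ assigns to $0\le m<\binom nk_q$ a $k$-dimensional subspace of $F^n$: it is $\{0\}$ if $k=0$ and $F^n$ if $k=n$; otherwise it is $\mathcal E_{n-1,k}(m)\times\{0\}$ if $m<\binom{n-1}{k}_q$, and in the remaining case, with $t=m-\binom{n-1}{k}_q+1$, $i=\lfloor t/q^{n-k}\rfloor \bmod \binom{n-1}{k-1}_q$, $j=t\bmod q^{n-k}$, $U=\mathcal E_{n-1,k-1}(i)$ and $r_0<\dots<r_{n-k-1}$ the elements of $\{0,\dots,n-2\}\setminus\Lambda(U)$, it is the sum of $U\times\{0\}$ and the line spanned by $e_{n-1}+\sum_{\ell}\alpha_{[j]_\ell}e_{r_\ell}$, where $[j]_\ell$ is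 the $\ell$-th base $q$ digit of $j$. **Canonical matrix.** A $k$-dimensional $W\subseteq F^n$ is given by the matrix $\tau(A)$, where $A$ is its $k\times n$ reduced row echelon matrix. If $k=0$, $\tau(A)=A$. If the last column of $A$ is zero, $\tau(A)$ is $\tau$ of $A$ without that column, with a zero column appended. Otherwise let row $i$ be the lowest row with non-zero last entry; scale it to last entry $1$, subtract multiples of it from the other rows to clear the last column, delete row $i$ and the last column, apply $\tau$, append a zero column and re-insert the (scaled) row $i$ as $i$-th row. **Decoding function.** On canonical matrices: $\mathcal D_{n,k}(W)=0$ if $k=0$ or $k=n$; $\mathcal D_{n,k}(W)=\mathcal D_{n-1,k}(W)$ (last column deleted) if the last column of $W$ is zero; otherwise, with $v$ the unique row with a non-zero last entry, $W'$ the matrix $W$ without this row and without the last column, and $r_0<\dots<r_{n-k-1}$ the elements of $\{0,\dots,n-2\}\setminus\Lambda(W')$, $$\mathcal D_{n,k}(W)=\binom{n-1}{k}_q+\Big(\Big(q^{n-k}\mathcal D_{n-1,k-1}(W')-1+\sum_{\ell=0}^{n-k-1}\rho(v_{r_\ell})q^\ell\Big)\bmod q^{n-k}\binom{n-1}{k-1}_q\Big).$$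 **Operations.** Consider programs for a random access machine that works with integers in base $q$. It has index cells (copying, incrementing, decrementing, comparing, indirect addressing, reading a symbol $\rho(W_{r,c})$ of the input matrix; each of these and each branch is one operation) and integer cells (copying, assembling a number from a list of digits, adding, subtracting, comparing, shifting by or truncating modulo a power of $q$; each charged the number of digits touched). The only other instruction is the multiplication of two integers of at most $m$ digits, which is charged $M[m]$ operations, where $M[1]\ge1$ and $M[m]/m$ is non-decreasing. A program does not depend on $q,n,k,F,\rho,M$. **Theorem.** There are a program and an absolute constant $C$ such that for all $q,F,\rho,M$ as above, all $1\le k\le n$ and every $k$-dimensional subspace $W\subseteq F^n$: the number $\mathcal D_{n,k}(W)$ lies in $\{0,\dots,\binom nk_q-1\}$ and $\mathcal E_{n,k}(\mathcal D_{n,k}(W))=W$; and the program, given $n$, $k$, $\rho(0)$ and the canonical matrix of $W$, halts with output $\mathcal D_{n,k}(W)$ after at most $$C\cdot M[nk]\cdot k\cdot\max(1,\log_2 k)$$ operations. In particular, for $k\ge2$ the decoding algorithm may be run using $O(M[nk]\,k\log k)$ operations. -/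

import Mathlib

namespace GrassmannDecoding

/-! ### Gaussian coefficients, echelon forms and canonical matrices -/

/-- The Gaussian coefficient: the product of `q^n - 1, ..., q^(n-k+1) - 1` divided by the product of
`q^k - 1, ..., q - 1` (the division is exact when `2 ≤ q`). -/
def gauss (q n k : ℕ) : ℕ :=
  (∏ i ∈ Finset.range k, (q ^ (n - i) - 1)) / ∏ i ∈ Finset.range k, (q ^ (i + 1) - 1)

variable {F : Type*} [Field F]

/-- The set of columns of `A` that hold the leading coefficient of some row. -/
def leadCols [DecidableEq F] {n k : ℕ} (A : Matrix (Fin k) (Fin n) F) : Finset (Fin n) :=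
  Finset.univ.filter fun c => ∃ i, A.IsLeadingEntry i c

open Classical in
/-- The set of columns that hold the leading coefficients of the (reduced) row echelon form of a
subspace `W`: these are exactly the leading positions of the non-zero vectors of `W`. -/
noncomputable def leadColsOf {n : ℕ} (W : Submodule F (Fin n → F)) : Finset (Fin n) :=
  Finset.univ.filter fun c => ∃ w ∈ W, (∀ c' < c, w c' = 0) ∧ w c ≠ 0

/-- If `r_0 < r_1 < ...` are the elements outside `L` then `posOutside L (r_l) = l`. -/
def posOutside {n : ℕ} (L : Finset (Fin n)) (c : Fin n) : ℕ :=
  (Finset.univ.filter fun c' => c' < c ∧ c' ∉ L).card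

/-- The bottom-most row of `A` with a non-zero entry in the last column (row `0` if there is no such
row). -/
noncomputable def bottomRow [DecidableEq F] {n k : ℕ} (A : Matrix (Fin (k + 1)) (Fin (n + 1)) F) : Fin (k + 1) :=
  (Finset.univ.filter fun i => A i (Fin.last n) ≠ 0).sup id

/-- The transformation that turns the reduced row echelon matrix of a subspace into its canonical
matrix. -/
noncomputable def canonical [DecidableEq F] :
    (n k : ℕ) → Matrix (Fin k) (Fin n) F → Matrix (Fin k) (Fin n) F
  | _, 0, A => A
  | 0, _ + 1, A => A
  | n + 1, k + 1, A =>
    if ∀ i, A i (Fin.last n) = 0 then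
      fun i => Fin.snoc (canonical n (k + 1) (A.submatrix id Fin.castSucc) i) (0 : F)
    else
      let i := bottomRow A
      let v : Fin (n + 1) → F := (A i (Fin.last n))⁻¹ • A i
      let B : Matrix (Fin k) (Fin n) F := fun r c =>
        A (i.succAbove r) c.castSucc - A (i.succAbove r) (Fin.last n) * v c.castSucc
      i.insertNth (α := fun _ => Fin (n + 1) → F) v fun r => Fin.snoc (canonical n k B r) (0 : F)

/-! ### The encoding and the decoding function -/

/-- Appending a zero coordinate: the inclusion of the simple `n`-dimensional subspace. -/
def appendZero (F : Type*) [Field F] (n : ℕ) : (Fin n → F) →ₗ[F] (Fin (n + 1) → F) where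
  toFun w := Fin.snoc w (0 : F)
  map_add' v w := by
    ext c
    refine Fin.lastCases ?_ (fun c => ?_) c <;> simp
  map_smul' a w := by
    ext c
    refine Fin.lastCases ?_ (fun c => ?_) c <;> simp

/-- The vector `e_n + ∑ α_{[j]_l} e_{r_l}`, where `r_0 < r_1 < ...` are the positions below `n` outside
`L`, `[j]_l` is the `l`-th digit of `j` in base `q` and `α_d` is the field element of number `d`. -/
def newVector {q : ℕ} (ρ : F ≃ Fin q) {n : ℕ} (L : Finset (Fin n)) (j : ℕ) : Fin (n + 1) → F :=
  Fin.snoc (fun c => if c ∈ L then 0 else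
    ρ.symm ⟨j / q ^ posOutside L c % q, Nat.mod_lt _ (Fin.pos (ρ 0))⟩) (1 : F)

/-- The encoding function: the subspace of index `m`, for the numbering `ρ` of the field elements. -/
noncomputable def encode {q : ℕ} (ρ : F ≃ Fin q) :
    (n k : ℕ) → ℕ → Submodule F (Fin n → F)
  | _, 0, _ => ⊥
  | 0, _ + 1, _ => ⊤
  | n + 1, k + 1, m =>
    if k = n then ⊤
    else if m < gauss q n (k + 1) then (encode ρ n (k + 1) m).map (appendZero F n)
    else
      let t := m - gauss q n (k + 1) + 1
      let U := encode ρ n k (t / q ^ (n - k) % gauss q n k)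
      U.map (appendZero F n) ⊔ Submodule.span F {newVector ρ (leadColsOf U) (t % q ^ (n - k))}

/-- The decoding function, on canonical matrices. -/
noncomputable def decode [DecidableEq F] {q : ℕ} (ρ : F ≃ Fin q) :
    (n k : ℕ) → Matrix (Fin k) (Fin n) F → ℕ
  | _, 0, _ => 0
  | 0, _ + 1, _ => 0
  | n + 1, k + 1, A =>
    if k = n then 0
    else if ∀ i, A i (Fin.last n) = 0 then
      decode ρ n (k + 1) (A.submatrix id Fin.castSucc)
    else
      let i := bottomRow A
      let B : Matrix (Fin k) (Fin n) F := A.submatrix i.succAbove Fin.castSucc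
      let L := leadCols B
      let j := ∑ c ∈ Lᶜ, (ρ (A i c.castSucc) : ℕ) * q ^ posOutside L c
      gauss q n (k + 1) +
        (((q : ℤ) ^ (n - k) * decode ρ n k B - 1 + j) % ((q : ℤ) ^ (n - k) * gauss q n k)).toNat

/-! ### The machine model

A random access machine for computations with integers written in base `q`. It has index registers
and index arrays, which hold counters, addresses and single symbols, and integer registers and
integer arrays, which hold numbers in base `q`. Registers and arrays are named by the program,
positions in an array are given by an index register.

* On indices there are only copying, incrementing, decrementing and comparing, at unit cost. So
  an index is never larger than the inputs plus the running time, and no arithmetic of long numbers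
  can be hidden there.
* An instruction on integers is charged at least the number of base `q` digits that it touches.
* The multiplication of two numbers of at most `m` digits is charged `M m`. There is no instruction
  that divides, other than shifts by powers of `q`. -/

/-- The instructions. `x y` are index registers, `u v w` integer registers, `a` is (the name of) an
index array and `b` of an integer array. -/
inductive Instr where
  /-- `x := 0` -/
  | zero (x : ℕ)
  /-- `x := y` -/
  | copy (x y : ℕ)
  /-- `x := x + 1` -/
  | inc (x : ℕ)
  /-- `x := x - 1` (and `0` stays `0`) -/
  | dec (x : ℕ)
  /-- `x := a[y]` -/
  | load (x a y : ℕ)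
  /-- `a[y] := x` -/
  | store (a y x : ℕ)
  /-- `x :=` the symbol in row `y` and column `y'` of the input matrix -/
  | entry (x y y' : ℕ)
  /-- `w := u` -/
  | icopy (w u : ℕ)
  /-- `w := b[y]` -/
  | iload (w b y : ℕ)
  /-- `b[y] := w` -/
  | istore (b y w : ℕ)
  /-- `w :=` the number whose base `q` digits, from the least significant one on, are
  `a[0], ..., a[y-1]` (each taken modulo `q`) -/
  | pack (w a y : ℕ)
  /-- `w := u + v` -/
  | iadd (w u v : ℕ)
  /-- `w := u - v` (and `0` if `u < v`) -/
  | isub (w u v : ℕ)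
  /-- `w := u * q ^ y` -/
  | shl (w u y : ℕ)
  /-- `w :=` the integer part of `u / q ^ y` -/
  | shr (w u y : ℕ)
  /-- `w := u mod q ^ y` -/
  | trunc (w u y : ℕ)
  /-- `x := 1` if `u ≤ v`, otherwise `x := 0` -/
  | ile (x u v : ℕ)
  /-- `w := u * v` -/
  | imul (w u v : ℕ)

/-- The contents of the index registers, index arrays, integer registers and integer arrays. -/
structure State where
  idx : ℕ → ℕ
  arr : ℕ → ℕ → ℕ
  int : ℕ → ℕ
  iarr : ℕ → ℕ → ℕ

namespace State

/-- Write an index register. -/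
def setIdx (s : State) (x val : ℕ) : State := { s with idx := Function.update s.idx x val }

/-- Write a cell of an index array. -/
def setArr (s : State) (a pos val : ℕ) : State :=
  { s with arr := Function.update s.arr a (Function.update (s.arr a) pos val) }

/-- Write an integer register. -/
def setInt (s : State) (w val : ℕ) : State := { s with int := Function.update s.int w val }

/-- Write a cell of an integer array. -/
def setIArr (s : State) (b pos val : ℕ) : State :=
  { s with iarr := Function.update s.iarr b (Function.update (s.iarr b) pos val) }

end State

/-- The number of digits of `u` in base `q` (`1` for `u = 0`). -/
def len (q u : ℕ) : ℕ := Nat.log q u + 1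

/-- The effect of an instruction; `input` holds the symbols of the input matrix. -/
def Instr.eff (q : ℕ) (input : ℕ → ℕ → ℕ) (s : State) : Instr → State
  | .zero x => s.setIdx x 0
  | .copy x y => s.setIdx x (s.idx y)
  | .inc x => s.setIdx x (s.idx x + 1)
  | .dec x => s.setIdx x (s.idx x - 1)
  | .load x a y => s.setIdx x (s.arr a (s.idx y))
  | .store a y x => s.setArr a (s.idx y) (s.idx x)
  | .entry x y y' => s.setIdx x (input (s.idx y) (s.idx y'))
  | .icopy w u => s.setInt w (s.int u)
  | .iload w b y => s.setInt w (s.iarr b (s.idx y))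
  | .istore b y w => s.setIArr b (s.idx y) (s.int w)
  | .pack w a y => s.setInt w (∑ l ∈ Finset.range (s.idx y), (s.arr a l % q) * q ^ l)
  | .iadd w u v => s.setInt w (s.int u + s.int v)
  | .isub w u v => s.setInt w (s.int u - s.int v)
  | .shl w u y => s.setInt w (s.int u * q ^ s.idx y)
  | .shr w u y => s.setInt w (s.int u / q ^ s.idx y)
  | .trunc w u y => s.setInt w (s.int u % q ^ s.idx y)
  | .ile x u v => s.setIdx x (if s.int u ≤ s.int v then 1 else 0)
  | .imul w u v => s.setInt w (s.int u * s.int v)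

/-- The number of operations charged for an instruction, where `M m` is the number of operations of a
multiplication of two numbers of `m` digits. -/
def Instr.cost (q : ℕ) (M : ℕ → ℕ) (s : State) : Instr → ℕ
  | .zero _ => 1
  | .copy _ _ => 1
  | .inc _ => 1
  | .dec _ => 1
  | .load _ _ _ => 1
  | .store _ _ _ => 1
  | .entry _ _ _ => 1
  | .icopy _ u => len q (s.int u)
  | .iload _ b y => len q (s.iarr b (s.idx y))
  | .istore _ _ w => len q (s.int w)
  | .pack _ _ y => s.idx y + 1
  | .iadd _ u v => max (len q (s.int u)) (len q (s.int v))
  | .isub _ u v => max (len q (s.int u)) (len q (s.int v))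
  | .shl _ u y => len q (s.int u) + s.idx y
  | .shr _ u _ => len q (s.int u)
  | .trunc _ u _ => len q (s.int u)
  | .ile _ u v => max (len q (s.int u)) (len q (s.int v))
  | .imul _ u v => M (max (len q (s.int u)) (len q (s.int v)))

/-- Programs. A program is a finite text that does not depend on `q`, `n`, `k`, the field or `M`. -/
inductive Prog where
  | instr (c : Instr)
  | seq (p₁ p₂ : Prog)
  /-- if `x < y` then `p₁` else `p₂` -/
  | ifLt (x y : ℕ) (p₁ p₂ : Prog)
  /-- while `x < y` do `p` -/
  | whileLt (x y : ℕ) (p : Prog)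

/-- `Exec q M input p s s' t`: the program `p`, started in the state `s`, halts in the state `s'` after
`t` operations. Every test is charged one operation. -/
inductive Exec (q : ℕ) (M : ℕ → ℕ) (input : ℕ → ℕ → ℕ) : Prog → State → State → ℕ → Prop where
  | instr (c : Instr) (s : State) :
      Exec q M input (.instr c) s (c.eff q input s) (c.cost q M s)
  | seq {p₁ p₂ : Prog} {s s' s'' : State} {t₁ t₂ : ℕ}
      (h₁ : Exec q M input p₁ s s' t₁) (h₂ : Exec q M input p₂ s' s'' t₂) :
      Exec q M input (.seq p₁ p₂) s s'' (t₁ + t₂)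
  | ifTrue {x y : ℕ} {p₁ p₂ : Prog} {s s' : State} {t : ℕ}
      (hc : s.idx x < s.idx y) (h : Exec q M input p₁ s s' t) :
      Exec q M input (.ifLt x y p₁ p₂) s s' (t + 1)
  | ifFalse {x y : ℕ} {p₁ p₂ : Prog} {s s' : State} {t : ℕ}
      (hc : ¬ s.idx x < s.idx y) (h : Exec q M input p₂ s s' t) :
      Exec q M input (.ifLt x y p₁ p₂) s s' (t + 1)
  | whileTrue {x y : ℕ} {p : Prog} {s s' s'' : State} {t₁ t₂ : ℕ}
      (hc : s.idx x < s.idx y) (h₁ : Exec q M input p s s' t₁)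
      (h₂ : Exec q M input (.whileLt x y p) s' s'' t₂) :
      Exec q M input (.whileLt x y p) s s'' (t₁ + t₂ + 1)
  | whileFalse {x y : ℕ} {p : Prog} {s : State} (hc : ¬ s.idx x < s.idx y) :
      Exec q M input (.whileLt x y p) s s 1

/-- The input matrix as the machine sees it: the entries are replaced by their numbers. -/
def symbols {q : ℕ} (ρ : F ≃ Fin q) {n k : ℕ} (A : Matrix (Fin k) (Fin n) F) (r c : ℕ) : ℕ :=
  if h : r < k ∧ c < n then ρ (A ⟨r, h.1⟩ ⟨c, h.2⟩) else 0

/-- The initial state: the index registers `0`, `1`, `2` hold `n`, `k` and the number `z` of the zero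
of the field, everything else is `0`. -/
def initial (n k z : ℕ) : State where
  idx := fun x => if x = 0 then n else if x = 1 then k else if x = 2 then z else 0
  arr := fun _ _ => 0
  int := fun _ => 0
  iarr := fun _ _ => 0

end GrassmannDecoding

open GrassmannDecoding

/-! Correctness. Suppose that the first `m` columns have been decoded, `i` rows end in them, their
value is `D`, and a further row ends in column `m` and gives the number `j`. Put `X = q^(m-i) * D +
j`. Since `D < gauss q m i` and `j < q^(m-i)`, the modular reduction in the decoding function acts
only when `X = 0`, where it wraps round to the last index. The encoder recovers `X` as its `t`, or
meets the full modulus in the wrapped case; quotient and remainder give back `D` and `j`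
(`encode_decodeStep`). The digits of `j` determine the new row, because a canonical row ends in `1`
and vanishes at the leading columns of the rows before it (`canonical_spec`, `newVector_eq`).
Pascal's rule gives the range, and it also turns the wrapped case into a mere change of index: the
new value is always `gauss q a (i + 1) + X - 1`, where `a = m + 1` if `X = 0` and `a = m` otherwise
(`decodeStep_eq`).

Running time. Each of the `k` rows thus needs one Gaussian coefficient, and everything else is
linear in the number of digits. Every Gaussian coefficient that occurs is below `q^(n*k)`, so the
exact division may be done modulo `q^(n*k)`, as a multiplication by the inverse of the denominator
(`prod_mul_mod_eq_gauss`). The inverse of `q^i - 1` is minus a truncated geometric series, whose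
digits are simply written down (`onesAt_modEq`); one multiplication per row keeps the inverse of the
whole denominator up to date. The numerator is multiplied out in a binary tree stored as a heap.
Node `x` multiplies numbers of at most `n*k/x` digits (`halts_heapProg`), which costs at most `M
(n*k) / x` because `M m / m` is non-decreasing. Summing over `x` gives a harmonic sum, hence the
factor `log k` (`IsMulCost.sum_div_le`).

The program reads the columns from left to right, reversing the recursion of the decoding function;
`Trace` describes this run, and `trace_of_isPrefix` links the two. -/

namespace GrassmannDecoding

variable {F : Type*} [Field F]

/-! ### Gaussian coefficients: exactness, Pascal's rule, size. -/

theorem prod_pow_sub_succ (q n k : ℕ) :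
    ∏ i ∈ Finset.range (k + 1), (q ^ (n + 1 - i) - 1) =
      (q ^ (n + 1) - 1) * ∏ i ∈ Finset.range k, (q ^ (n - i) - 1) := by
  rw [Finset.prod_range_succ', mul_comm]
  simp

/-- Split `q^(n+1) - 1 = (q^(n-k) - 1) + q^(n-k) * (q^(k+1) - 1)`. Being free of division, this form
serves both to show that the division in `gauss` is exact and to derive Pascal's rule. -/
theorem prod_pow_sub_pascal {q : ℕ} (hq : 1 ≤ q) {n k : ℕ} (hk : k ≤ n) :
    ∏ i ∈ Finset.range (k + 1), (q ^ (n + 1 - i) - 1) =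
      ∏ i ∈ Finset.range (k + 1), (q ^ (n - i) - 1) +
        q ^ (n - k) * ((∏ i ∈ Finset.range k, (q ^ (n - i) - 1)) * (q ^ (k + 1) - 1)) := by
  rw [prod_pow_sub_succ, Finset.prod_range_succ]
  have h1 : 1 ≤ q ^ (n + 1) := Nat.one_le_pow _ _ hq
  have h2 : 1 ≤ q ^ (n - k) := Nat.one_le_pow _ _ hq
  have h3 : 1 ≤ q ^ (k + 1) := Nat.one_le_pow _ _ hq
  have h4 : q ^ (n + 1) = q ^ (n - k) * q ^ (k + 1) := by rw [← pow_add]; congr 1; omega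
  zify [h1, h2, h3]
  have h4' : (q : ℤ) ^ (n + 1) = q ^ (n - k) * q ^ (k + 1) := by exact_mod_cast h4
  rw [h4']; ring

theorem prod_pow_sub_eq_zero (q : ℕ) {n k : ℕ} (hk : n < k) :
    ∏ i ∈ Finset.range k, (q ^ (n - i) - 1) = 0 :=
  Finset.prod_eq_zero (Finset.mem_range.2 hk) (by simp)

theorem prod_pow_succ_sub_pos {q : ℕ} (hq : 2 ≤ q) (k : ℕ) :
    0 < ∏ i ∈ Finset.range k, (q ^ (i + 1) - 1) :=
  Finset.prod_pos fun i _ => by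
    exact Nat.sub_pos_of_lt (Nat.one_lt_pow (Nat.succ_ne_zero i) hq)

theorem prod_pow_succ_sub_dvd {q : ℕ} (hq : 1 ≤ q) (n k : ℕ) :
    ∏ i ∈ Finset.range k, (q ^ (i + 1) - 1) ∣ ∏ i ∈ Finset.range k, (q ^ (n - i) - 1) := by
  induction n generalizing k with
  | zero =>
    cases k with
    | zero => simp
    | succ k => simp
  | succ n ih =>
    cases k with
    | zero => simp
    | succ k =>
      rcases le_or_gt k n with hk | hk
      · rw [prod_pow_sub_pascal hq hk]
        refine dvd_add (ih _) (Dvd.dvd.mul_left ?_ _)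
        rw [Finset.prod_range_succ]
        exact mul_dvd_mul (ih _) dvd_rfl
      · rw [prod_pow_sub_eq_zero q (by omega)]
        exact dvd_zero _

theorem gauss_mul_prod {q : ℕ} (hq : 2 ≤ q) (n k : ℕ) :
    gauss q n k * ∏ i ∈ Finset.range k, (q ^ (i + 1) - 1) =
      ∏ i ∈ Finset.range k, (q ^ (n - i) - 1) :=
  Nat.div_mul_cancel (prod_pow_succ_sub_dvd (by omega) n k)

theorem gauss_pascal {q : ℕ} (hq : 2 ≤ q) {n k : ℕ} (hk : k ≤ n) :
    gauss q (n + 1) (k + 1) = gauss q n (k + 1) + q ^ (n - k) * gauss q n k := by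
  refine Nat.eq_of_mul_eq_mul_right (prod_pow_succ_sub_pos hq (k + 1)) ?_
  rw [gauss_mul_prod hq, prod_pow_sub_pascal (by omega) hk, add_mul, gauss_mul_prod hq,
    Finset.prod_range_succ (fun i => q ^ (i + 1) - 1), ← gauss_mul_prod hq n k]
  ring

theorem gauss_zero_right (q n : ℕ) : gauss q n 0 = 1 := by simp [gauss]

theorem gauss_eq_zero {q : ℕ} {n k : ℕ} (hk : n < k) : gauss q n k = 0 := by
  simp [gauss, prod_pow_sub_eq_zero q hk]

theorem gauss_self {q : ℕ} (hq : 2 ≤ q) (n : ℕ) : gauss q n n = 1 := by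
  induction n with
  | zero => exact gauss_zero_right q 0
  | succ n ih => rw [gauss_pascal hq le_rfl, gauss_eq_zero (Nat.lt_succ_self n), ih]; simp

theorem gauss_pos {q : ℕ} (hq : 2 ≤ q) {n k : ℕ} (hk : k ≤ n) : 0 < gauss q n k := by
  refine Nat.pos_of_ne_zero fun h => ?_
  have := gauss_mul_prod hq n k
  rw [h, zero_mul, eq_comm, Finset.prod_eq_zero_iff] at this
  obtain ⟨i, hi, h⟩ := this
  have := Nat.one_lt_pow (n := n - i) (by have := Finset.mem_range.1 hi; omega) hq
  omega

/-- The `n * k` digits are the working precision of the program. The bound holds already for the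
numerator of `gauss`, so it covers the product formed before the division as well. -/
theorem prod_pow_sub_lt {q : ℕ} (hq : 2 ≤ q) (n : ℕ) {k : ℕ} (hk : 1 ≤ k) :
    ∏ i ∈ Finset.range k, (q ^ (n - i) - 1) < q ^ (n * k) := by
  rw [pow_mul]
  induction k, hk using Nat.le_induction with
  | base =>
    have : 1 ≤ q ^ n := Nat.one_le_pow _ _ (by omega)
    simp; omega
  | succ k hk ih =>
    rw [Finset.prod_range_succ, pow_succ]
    refine Nat.mul_lt_mul_of_lt_of_le ih ?_ (by positivity)
    exact (Nat.sub_le _ _).trans (Nat.pow_le_pow_right (by omega) (Nat.sub_le _ _))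

theorem gauss_lt {q : ℕ} (hq : 2 ≤ q) (n : ℕ) {k : ℕ} (hk : 1 ≤ k) :
    gauss q n k < q ^ (n * k) := by
  refine lt_of_le_of_lt ?_ (prod_pow_sub_lt hq n hk)
  exact Nat.div_le_self _ _

/-! ### Numbers assembled from the entries outside a set of columns. -/

/-- The number of positions below `c` outside `L`. -/
def posBelow (L : Finset ℕ) (c : ℕ) : ℕ := (Finset.range c \ L).card

/-- The number whose base `q` digits are the values of `d` at the positions below `m` outside `L`. -/
def packOutside (q : ℕ) (L : Finset ℕ) (d : ℕ → ℕ) (m : ℕ) : ℕ :=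
  ∑ c ∈ Finset.range m \ L, d c * q ^ posBelow L c

theorem range_succ_sdiff_of_mem {L : Finset ℕ} {c : ℕ} (h : c ∈ L) :
    Finset.range (c + 1) \ L = Finset.range c \ L := by
  rw [Finset.range_add_one, Finset.insert_sdiff_of_mem _ h]

theorem range_succ_sdiff_of_notMem {L : Finset ℕ} {c : ℕ} (h : c ∉ L) :
    Finset.range (c + 1) \ L = insert c (Finset.range c \ L) := by
  rw [Finset.range_add_one, Finset.insert_sdiff_of_notMem _ h]

theorem posBelow_succ_of_mem {L : Finset ℕ} {c : ℕ} (h : c ∈ L) :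
    posBelow L (c + 1) = posBelow L c := by
  rw [posBelow, range_succ_sdiff_of_mem h, posBelow]

theorem posBelow_succ_of_notMem {L : Finset ℕ} {c : ℕ} (h : c ∉ L) :
    posBelow L (c + 1) = posBelow L c + 1 := by
  rw [posBelow, range_succ_sdiff_of_notMem h, Finset.card_insert_of_notMem (by simp), posBelow]

theorem packOutside_succ_of_mem {q : ℕ} {L : Finset ℕ} {d : ℕ → ℕ} {c : ℕ} (h : c ∈ L) :
    packOutside q L d (c + 1) = packOutside q L d c := by
  rw [packOutside, range_succ_sdiff_of_mem h, packOutside]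

theorem packOutside_succ_of_notMem {q : ℕ} {L : Finset ℕ} {d : ℕ → ℕ} {c : ℕ} (h : c ∉ L) :
    packOutside q L d (c + 1) = packOutside q L d c + d c * q ^ posBelow L c := by
  rw [packOutside, range_succ_sdiff_of_notMem h, Finset.sum_insert (by simp), packOutside, add_comm]

theorem posBelow_mono (L : Finset ℕ) : Monotone (posBelow L) := fun _ _ h =>
  Finset.card_le_card (Finset.sdiff_subset_sdiff (Finset.range_subset_range.2 h) le_rfl)

theorem posBelow_of_subset {L : Finset ℕ} {m : ℕ} (h : L ⊆ Finset.range m) :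
    posBelow L m = m - L.card := by
  rw [posBelow, Finset.card_sdiff_of_subset h, Finset.card_range]

theorem packOutside_lt {q : ℕ} {L : Finset ℕ} {d : ℕ → ℕ} (hd : ∀ c, d c < q) (m : ℕ) :
    packOutside q L d m < q ^ posBelow L m := by
  induction m with
  | zero => simp [packOutside, posBelow]
  | succ m ih =>
    by_cases h : m ∈ L
    · rwa [packOutside_succ_of_mem h, posBelow_succ_of_mem h]
    · rw [packOutside_succ_of_notMem h, posBelow_succ_of_notMem h, pow_succ]
      have := hd m
      nlinarith [Nat.mul_le_mul_right (q ^ posBelow L m) (Nat.succ_le_of_lt this)]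

/-- Earlier positions together contribute less than `q ^ posBelow L c`, later ones a multiple of `q
^ (posBelow L c + 1)`. So `newVector` reads back the entries from which `j` was assembled. -/
theorem packOutside_digit {q : ℕ} {L : Finset ℕ} {d : ℕ → ℕ} (hd : ∀ c, d c < q) {m c : ℕ}
    (hc : c < m) (hL : c ∉ L) : packOutside q L d m / q ^ posBelow L c % q = d c := by
  have hq : 0 < q := (Nat.zero_le _).trans_lt (hd 0)
  induction m with
  | zero => omega
  | succ m ih =>
    by_cases h : m ∈ L
    · rw [packOutside_succ_of_mem h]
      exact ih (lt_of_le_of_ne (by omega) fun e => hL (e ▸ h))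
    · rw [packOutside_succ_of_notMem h]
      rcases eq_or_lt_of_le (Nat.lt_succ_iff.1 hc) with rfl | hcm
      · rw [Nat.add_mul_div_right _ _ (pow_pos hq _), Nat.div_eq_of_lt (packOutside_lt hd _),
          zero_add, Nat.mod_eq_of_lt (hd _)]
      · have h1 : posBelow L c + 1 ≤ posBelow L m := by
          rw [← posBelow_succ_of_notMem hL]; exact posBelow_mono L hcm
        obtain ⟨e, he⟩ := Nat.exists_eq_add_of_le h1
        rw [he, show d m * q ^ (posBelow L c + 1 + e) = d m * q ^ e * q * q ^ posBelow L c by ring,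
          Nat.add_mul_div_right _ _ (pow_pos hq _), Nat.add_mul_mod_self_right, ih hcm]

theorem posOutside_eq_posBelow {n : ℕ} (L : Finset (Fin n)) (c : Fin n) :
    posOutside L c = posBelow (L.map Fin.valEmbedding) c := by
  rw [posOutside, posBelow, ← Finset.card_map Fin.valEmbedding]
  congr 1
  ext x
  simp only [Finset.mem_map, Finset.mem_filter, Finset.mem_univ, true_and, Fin.valEmbedding_apply,
    Finset.mem_sdiff, Finset.mem_range]
  constructor
  · rintro ⟨a, ⟨h1, h2⟩, rfl⟩
    refine ⟨h1, ?_⟩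
    rintro ⟨b, hb, hab⟩
    exact h2 (Fin.ext hab ▸ hb)
  · rintro ⟨h1, h2⟩
    exact ⟨⟨x, h1.trans c.2⟩, ⟨h1, fun h => h2 ⟨_, h, rfl⟩⟩, rfl⟩

/-- With columns in `ℕ` instead of `Fin n`, sets of leading columns of different prefixes can be
compared without casts. -/
theorem sum_compl_eq_packOutside {n q : ℕ} (L : Finset (Fin n)) (d : ℕ → ℕ) :
    ∑ c ∈ Lᶜ, d c * q ^ posOutside L c = packOutside q (L.map Fin.valEmbedding) d n := by
  rw [packOutside, eq_comm]
  have : Finset.range n \ L.map Fin.valEmbedding = Lᶜ.map Fin.valEmbedding := by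
    ext x
    simp only [Finset.mem_map, Fin.valEmbedding_apply, Finset.mem_sdiff, Finset.mem_range,
      Finset.mem_compl]
    constructor
    · rintro ⟨h1, h2⟩
      exact ⟨⟨x, h1⟩, fun h => h2 ⟨_, h, rfl⟩, rfl⟩
    · rintro ⟨a, h, rfl⟩
      refine ⟨a.2, ?_⟩
      rintro ⟨b, hb, hab⟩
      exact h (Fin.ext hab ▸ hb)
  rw [this, Finset.sum_map]
  exact Finset.sum_congr rfl fun c _ => by rw [posOutside_eq_posBelow]; rfl

/-- As `Q * D + j < Q * g`, the reduction is void unless the subtraction of `1` leads below zero. -/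
theorem toNat_mod_eq {Q g D j : ℕ} (hD : D < g) (hj : j < Q) :
    (((Q : ℤ) * D - 1 + j) % ((Q : ℤ) * g)).toNat =
      if Q * D + j = 0 then Q * g - 1 else Q * D + j - 1 := by
  have hb : Q * D + j < Q * g := by nlinarith
  split_ifs with h
  · have h1 : (Q : ℤ) * D - 1 + j = -1 := by
      have : (Q : ℤ) * D + j = 0 := by exact_mod_cast h
      linarith
    rw [h1, ← Int.add_emod_right, show (-1 : ℤ) + (Q : ℤ) * g = ((Q * g - 1 : ℕ) : ℤ) by
      rw [Nat.cast_sub (by omega)]; push_cast; ring, show (Q : ℤ) * g = ((Q * g : ℕ) : ℤ) by simp,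
      ← Int.natCast_mod, Int.toNat_natCast, Nat.mod_eq_of_lt (by omega)]
  · rw [show (Q : ℤ) * D - 1 + j = ((Q * D + j - 1 : ℕ) : ℤ) by
      rw [Nat.cast_sub (by omega)]; push_cast; ring, show (Q : ℤ) * g = ((Q * g : ℕ) : ℤ) by simp,
      ← Int.natCast_mod, Int.toNat_natCast, Nat.mod_eq_of_lt (by omega)]

/-! ### Leading entries -/

theorem isLeadingEntry_submatrix_castSucc {n k l : ℕ} {A : Matrix (Fin k) (Fin (n + 1)) F}
    {f : Fin l → Fin k} {r : Fin l} {c : Fin n} :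
    (A.submatrix f Fin.castSucc).IsLeadingEntry r c ↔ A.IsLeadingEntry (f r) c.castSucc := by
  simp only [Matrix.IsLeadingEntry, Matrix.submatrix_apply]
  refine and_congr_left fun _ => ⟨fun h j hj => ?_, fun h j hj => h _ (Fin.castSucc_lt_castSucc_iff.2 hj)⟩
  have hj' : j ≠ Fin.last n := fun e => by subst e; exact absurd hj (Fin.le_last _).not_gt
  have := h (j.castPred hj') (by rwa [← Fin.castSucc_lt_castSucc_iff, Fin.castSucc_castPred])
  rwa [Fin.castSucc_castPred] at this

/-- Every row has a leading entry, and the leading entries are in different columns. -/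
structure HasDistinctLeads {n k : ℕ} (A : Matrix (Fin k) (Fin n) F) : Prop where
  exists_lead : ∀ r, ∃ c, A.IsLeadingEntry r c
  eq_row : ∀ {r r' c}, A.IsLeadingEntry r c → A.IsLeadingEntry r' c → r = r'

namespace HasDistinctLeads

variable {n k : ℕ} {A : Matrix (Fin k) (Fin n) F}

theorem card_leadCols [DecidableEq F] (h : HasDistinctLeads A) : (leadCols A).card = k := by
  choose c hc using h.exists_lead
  have : leadCols A = Finset.univ.map ⟨c, fun r r' e => h.eq_row (hc r) (e ▸ hc r')⟩ := by
    ext x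
    simp only [leadCols, Finset.mem_filter, Finset.mem_univ, true_and, Finset.mem_map]
    exact ⟨fun ⟨i, hi⟩ => ⟨i, (hc i).unique hi⟩, fun ⟨i, hi⟩ => ⟨i, hi ▸ hc i⟩⟩
  rw [this, Finset.card_map, Finset.card_univ, Fintype.card_fin]

/-- Among the rows with non-zero coefficient take the one that leads leftmost. No other such row
contributes in its leading column, so nothing cancels there. The leading columns of the span and
linear independence both follow. -/
theorem exists_lead_sum (h : HasDistinctLeads A) {a : Fin k → F} (ha : a ≠ 0) :
    ∃ r c, A.IsLeadingEntry r c ∧ (∀ j < c, ∑ i, a i * A i j = 0) ∧ ∑ i, a i * A i c ≠ 0 := by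
  classical
  choose c hc using h.exists_lead
  obtain ⟨r0, hr0⟩ := Function.ne_iff.1 ha
  obtain ⟨r, hr, hmin⟩ := Finset.exists_min_image (Finset.univ.filter fun r => a r ≠ 0) c
    ⟨r0, by simpa using hr0⟩
  simp only [Finset.mem_filter, Finset.mem_univ, true_and] at hr hmin
  refine ⟨r, c r, hc r, fun j hj => Finset.sum_eq_zero fun i _ => ?_, ?_⟩
  · by_cases hi : a i = 0
    · simp [hi]
    · rw [(hc i).1 j (hj.trans_le (hmin i hi)), mul_zero]
  · rw [Finset.sum_eq_single r]
    · exact mul_ne_zero hr (hc r).2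
    · intro i _ hir
      by_cases hi : a i = 0
      · simp [hi]
      · rw [(hc i).1 _ (lt_of_le_of_ne (hmin i hi) fun e => hir (h.eq_row (hc i) (e ▸ hc r))),
          mul_zero]
    · simp

theorem leadColsOf_span [DecidableEq F] (h : HasDistinctLeads A) :
    leadColsOf (Submodule.span F (Set.range A)) = leadCols A := by
  ext x
  simp only [leadColsOf, leadCols, Finset.mem_filter, Finset.mem_univ, true_and]
  constructor
  · rintro ⟨w, hw, h1, h2⟩
    obtain ⟨a, rfl⟩ := (Submodule.mem_span_range_iff_exists_fun F).1 hw
    have hval : ∀ j, (∑ i, a i • A i) j = ∑ i, a i * A i j := fun j => by simp [Finset.sum_apply]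
    have ha : a ≠ 0 := by rintro rfl; simp at h2
    obtain ⟨r, c, hrc, h3, h4⟩ := h.exists_lead_sum ha
    simp only [hval] at h1 h2
    have : x = c := le_antisymm (not_lt.1 fun hl => h4 (h1 c hl)) (not_lt.1 fun hl => h2 (h3 x hl))
    exact ⟨r, this ▸ hrc⟩
  · rintro ⟨i, hi⟩
    exact ⟨A i, Submodule.subset_span ⟨i, rfl⟩, hi.1, hi.2⟩

theorem linearIndependent (h : HasDistinctLeads A) : LinearIndependent F (fun i => A i) := by
  rw [Fintype.linearIndependent_iff]
  intro a ha
  by_contra hne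
  push Not at hne
  obtain ⟨i, hi⟩ := hne
  obtain ⟨r, c, -, -, h4⟩ := h.exists_lead_sum (a := a) (fun e => hi (congrFun e i))
  apply h4
  simpa [Finset.sum_apply] using congrFun ha c

theorem span_eq_top {A : Matrix (Fin n) (Fin n) F} (h : HasDistinctLeads A) :
    Submodule.span F (Set.range A) = ⊤ :=
  h.linearIndependent.span_eq_top_of_card_eq_finrank' (by simp)

end HasDistinctLeads

/-! ### Canonical matrices -/

/-- A description of the matrices that `canonical` produces. -/
def IsCanonical : (n k : ℕ) → Matrix (Fin k) (Fin n) F → Prop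
  | _, 0, _ => True
  | 0, _ + 1, _ => False
  | n + 1, k + 1, A =>
    ((∀ i, A i (Fin.last n) = 0) ∧ IsCanonical n (k + 1) (A.submatrix id Fin.castSucc)) ∨
    ∃ i, A i (Fin.last n) = 1 ∧ (∀ r, A (Fin.succAbove i r) (Fin.last n) = 0) ∧
      (∀ r c, (A.submatrix i.succAbove Fin.castSucc).IsLeadingEntry r c → A i c.castSucc = 0) ∧
      IsCanonical n k (A.submatrix i.succAbove Fin.castSucc)

/-- The row `i` vanishes at the leading columns of the other rows, so its own leading column is a
new one. -/
theorem IsCanonical.hasDistinctLeads {n k : ℕ} {A : Matrix (Fin k) (Fin n) F}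
    (h : IsCanonical n k A) : HasDistinctLeads A := by
  induction n generalizing k with
  | zero =>
    cases k with
    | zero => exact ⟨fun r => r.elim0, fun {r} => r.elim0⟩
    | succ k => exact h.elim
  | succ n ih =>
    cases k with
    | zero => exact ⟨fun r => r.elim0, fun {r} => r.elim0⟩
    | succ k =>
      rcases h with ⟨h0, h⟩ | ⟨i, hi, h0, hL, h⟩
      · have := ih h
        refine ⟨fun r => ?_, fun {r r' c} h1 h2 => ?_⟩
        · obtain ⟨c, hc⟩ := this.exists_lead r
          exact ⟨_, isLeadingEntry_submatrix_castSucc.1 hc⟩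
        · refine Fin.lastCases (fun h1 _ => absurd (h0 r) h1.2) (fun c h1 h2 => ?_) c h1 h2
          exact this.eq_row (isLeadingEntry_submatrix_castSucc (f := id).2 h1)
            (isLeadingEntry_submatrix_castSucc (f := id).2 h2)
      · have := ih h
        have hlead : ∀ r c, A.IsLeadingEntry (i.succAbove r) c → ¬ A.IsLeadingEntry i c := by
          intro r c
          refine Fin.lastCases (fun h1 _ => h1.2 (h0 r)) (fun c h1 h2 => ?_) c
          exact h2.2 (hL r c (isLeadingEntry_submatrix_castSucc.2 h1))
        refine ⟨fun r => ?_, fun {r r' c} h1 h2 => ?_⟩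
        · refine Fin.succAboveCases i ?_ (fun r => ?_) r
          · exact Matrix.row_ne_zero_iff_exists_isLeadingEntry.1 fun e => by simp [e] at hi
          · obtain ⟨c, hc⟩ := this.exists_lead r
            exact ⟨_, isLeadingEntry_submatrix_castSucc.1 hc⟩
        · rcases Fin.eq_self_or_eq_succAbove i r with e | ⟨a, e⟩ <;>
            rcases Fin.eq_self_or_eq_succAbove i r' with e' | ⟨b, e'⟩ <;> rw [e] at h1 ⊢ <;>
            rw [e'] at h2 ⊢
          · exact absurd h1 (hlead _ _ h2)
          · exact absurd h2 (hlead _ _ h1)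
          · congr 1
            refine Fin.lastCases (fun h1 _ => absurd (h0 a) h1.2) (fun c h1 h2 => ?_) c h1 h2
            exact this.eq_row (isLeadingEntry_submatrix_castSucc.2 h1)
              (isLeadingEntry_submatrix_castSucc.2 h2)

theorem IsCanonical.le {n k : ℕ} {A : Matrix (Fin k) (Fin n) F} (h : IsCanonical n k A) :
    k ≤ n := by
  classical
  rw [← h.hasDistinctLeads.card_leadCols]
  simpa using Finset.card_le_univ (leadCols A)

theorem appendZero_apply {n : ℕ} (w : Fin n → F) : appendZero F n w = Fin.snoc w (0 : F) := rfl

theorem map_span_range {V V' ι : Type*} [AddCommGroup V] [Module F V] [AddCommGroup V'] [Module F V']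
    (f : V →ₗ[F] V') (A : ι → V) : (Submodule.span F (Set.range A)).map f =
      Submodule.span F (Set.range fun i => f (A i)) := by
  rw [Submodule.map_span, ← Set.range_comp]; rfl

theorem span_range_of_last_eq_zero {n k : ℕ} {A : Matrix (Fin k) (Fin (n + 1)) F}
    (h : ∀ i, A i (Fin.last n) = 0) :
    Submodule.span F (Set.range A) =
      (Submodule.span F (Set.range (A.submatrix id Fin.castSucc))).map (appendZero F n) := by
  refine Eq.trans ?_ (map_span_range (appendZero F n) fun i => A.submatrix id Fin.castSucc i).symm
  congr 2
  ext i c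
  refine Fin.lastCases ?_ (fun c => ?_) c
  · simp [h, appendZero_apply]
  · simp [appendZero_apply]

theorem span_range_of_succAbove_last_eq_zero {n k : ℕ}
    {A : Matrix (Fin (k + 1)) (Fin (n + 1)) F} (i : Fin (k + 1))
    (h : ∀ r, A (i.succAbove r) (Fin.last n) = 0) :
    Submodule.span F (Set.range A) =
      (Submodule.span F (Set.range (A.submatrix i.succAbove Fin.castSucc))).map (appendZero F n) ⊔
        Submodule.span F {A i} := by
  have h1 := span_range_of_last_eq_zero (A := A.submatrix i.succAbove id) h
  rw [show A.submatrix i.succAbove Fin.castSucc =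
    (A.submatrix i.succAbove id).submatrix id Fin.castSucc from rfl, ← h1, ← Submodule.span_union]
  congr 1
  ext w
  constructor
  · rintro ⟨r, rfl⟩
    rcases Fin.eq_self_or_eq_succAbove i r with rfl | ⟨a, rfl⟩
    · exact Or.inr rfl
    · exact Or.inl ⟨a, rfl⟩
  · rintro (⟨a, rfl⟩ | h)
    · exact ⟨_, rfl⟩
    · exact ⟨i, h.symm⟩

/-- A weak form of being in reduced row echelon form with nonzero rows. -/
structure IsReduced {n k : ℕ} (A : Matrix (Fin k) (Fin n) F) : Prop where
  exists_lead : ∀ r, ∃ c, A.IsLeadingEntry r c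
  eq_zero : ∀ {r r' c}, A.IsLeadingEntry r c → r' ≠ r → A r' c = 0
  lt : ∀ {r r' c c'}, r < r' → A.IsLeadingEntry r c → A.IsLeadingEntry r' c' → c < c'

theorem _root_.Matrix.IsReducedRowEchelon.isReduced {n k : ℕ} {A : Matrix (Fin k) (Fin n) F}
    (h : A.IsReducedRowEchelon) (hA : ∀ i, A i ≠ 0) : IsReduced A where
  exists_lead r := Matrix.row_ne_zero_iff_exists_isLeadingEntry.1 (hA r)
  eq_zero h1 h2 := h.eq_zero_of_ne_of_isLeadingEntry h2 h1
  lt h1 h2 h3 := not_le.1 fun hl => h3.2 (h.isRowEchelon h1 fun j hj => h2.1 j (hj.trans_le hl))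

theorem bottomRow_spec [DecidableEq F] {n k : ℕ} {A : Matrix (Fin (k + 1)) (Fin (n + 1)) F}
    (h : ¬ ∀ i, A i (Fin.last n) = 0) :
    A (bottomRow A) (Fin.last n) ≠ 0 ∧ ∀ r, bottomRow A < r → A r (Fin.last n) = 0 := by
  push Not at h
  obtain ⟨i, hi⟩ := h
  constructor
  · obtain ⟨r, hr, e⟩ := Finset.exists_mem_eq_sup
      (Finset.univ.filter fun i => A i (Fin.last n) ≠ 0) ⟨i, by simpa using hi⟩ id
    rw [bottomRow, e]
    simpa using hr
  · intro r hr
    by_contra hne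
    exact hr.not_ge (Finset.le_sup (f := id) (b := r) (by simpa using hne))

theorem bottomRow_eq [DecidableEq F] {n k : ℕ} {A : Matrix (Fin (k + 1)) (Fin (n + 1)) F}
    {i : Fin (k + 1)} (hi : A i (Fin.last n) ≠ 0)
    (h : ∀ r, A (i.succAbove r) (Fin.last n) = 0) : bottomRow A = i := by
  rcases Fin.eq_self_or_eq_succAbove i (bottomRow A) with e | ⟨a, e⟩
  · exact e
  · have := (bottomRow_spec fun h' => hi (h' i)).1
    rw [e] at this
    exact absurd (h a) this

/-- The matrix obtained from `A` by clearing the last column by means of the row `i`. -/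
def clearLast {n k : ℕ} (A : Matrix (Fin (k + 1)) (Fin (n + 1)) F) (i : Fin (k + 1)) :
    Matrix (Fin k) (Fin n) F := fun r c =>
  A (i.succAbove r) c.castSucc -
    A (i.succAbove r) (Fin.last n) * ((A i (Fin.last n))⁻¹ • A i) c.castSucc

/-- A row above `i` leads strictly to the left of row `i`, so the subtracted multiple vanishes up to
that lead. From a row below `i` nothing is subtracted, its last entry being zero. This is the reason
for taking the bottom-most row as pivot. -/
theorem isLeadingEntry_clearLast {n k : ℕ} {A : Matrix (Fin (k + 1)) (Fin (n + 1)) F}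
    {i : Fin (k + 1)} (hA : IsReduced A)
    (h0 : ∀ r, i < r → A r (Fin.last n) = 0) {r : Fin k} {c : Fin (n + 1)}
    (h : A.IsLeadingEntry (i.succAbove r) c) :
    ∃ c' : Fin n, c'.castSucc = c ∧ (clearLast A i).IsLeadingEntry r c' := by
  rcases lt_or_gt_of_ne (Fin.succAbove_ne i r) with hlt | hlt
  · obtain ⟨d, hd⟩ := hA.exists_lead i
    have hcd := hA.lt hlt h hd
    refine ⟨c.castPred (hcd.trans_le (Fin.le_last d)).ne, by simp, ?_, ?_⟩
    · intro j hj
      have hj' : j.castSucc < c := by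
        rw [← Fin.castSucc_lt_castSucc_iff] at hj; simpa using hj
      simp [clearLast, h.1 _ hj', hd.1 _ (hj'.trans hcd)]
    · simpa [clearLast, hd.1 _ hcd] using h.2
  · have hc : c ≠ Fin.last n := by rintro rfl; exact h.2 (h0 _ hlt)
    refine ⟨c.castPred hc, by simp, ?_, ?_⟩
    · intro j hj
      have hj' : j.castSucc < c := by
        rw [← Fin.castSucc_lt_castSucc_iff] at hj; simpa using hj
      simp [clearLast, h.1 _ hj', h0 _ hlt]
    · simpa [clearLast, h0 _ hlt] using h.2

theorem isLeadingEntry_clearLast_iff {n k : ℕ} {A : Matrix (Fin (k + 1)) (Fin (n + 1)) F}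
    {i : Fin (k + 1)} (hA : IsReduced A)
    (h0 : ∀ r, i < r → A r (Fin.last n) = 0) {r : Fin k} {c : Fin n} :
    (clearLast A i).IsLeadingEntry r c ↔ A.IsLeadingEntry (i.succAbove r) c.castSucc := by
  constructor
  · intro h
    obtain ⟨d, hd⟩ := hA.exists_lead (i.succAbove r)
    obtain ⟨c', rfl, hc'⟩ := isLeadingEntry_clearLast hA h0 hd
    rwa [h.unique hc']
  · intro h
    obtain ⟨c', e, hc'⟩ := isLeadingEntry_clearLast hA h0 h
    rwa [← Fin.castSucc_injective _ e]

theorem IsReduced.clearLast {n k : ℕ} {A : Matrix (Fin (k + 1)) (Fin (n + 1)) F}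
    {i : Fin (k + 1)} (hA : IsReduced A) (h0 : ∀ r, i < r → A r (Fin.last n) = 0) :
    IsReduced (clearLast A i) where
  exists_lead r := by
    obtain ⟨d, hd⟩ := hA.exists_lead (i.succAbove r)
    obtain ⟨c', -, hc'⟩ := isLeadingEntry_clearLast hA h0 hd
    exact ⟨c', hc'⟩
  eq_zero {r r' c} h hne := by
    rw [isLeadingEntry_clearLast_iff hA h0] at h
    simp [GrassmannDecoding.clearLast, hA.eq_zero h (Fin.succAbove_right_injective.ne hne),
      hA.eq_zero h (Fin.succAbove_ne i r).symm]
  lt hlt h h' := by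
    rw [isLeadingEntry_clearLast_iff hA h0] at h h'
    exact Fin.castSucc_lt_castSucc_iff.1 (hA.lt (Fin.succAbove_lt_succAbove_iff.2 hlt) h h')

theorem IsReduced.submatrix_castSucc {n k : ℕ} {A : Matrix (Fin k) (Fin (n + 1)) F}
    (hA : IsReduced A) (h0 : ∀ r, A r (Fin.last n) = 0) :
    IsReduced (A.submatrix id Fin.castSucc) where
  exists_lead r := by
    obtain ⟨d, hd⟩ := hA.exists_lead r
    have hd' : d ≠ Fin.last n := by rintro rfl; exact hd.2 (h0 r)
    exact ⟨d.castPred hd', isLeadingEntry_submatrix_castSucc.2 (by simpa using hd)⟩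
  eq_zero h hne := hA.eq_zero (isLeadingEntry_submatrix_castSucc.1 h) hne
  lt hlt h h' := Fin.castSucc_lt_castSucc_iff.1
    (hA.lt hlt (isLeadingEntry_submatrix_castSucc.1 h) (isLeadingEntry_submatrix_castSucc.1 h'))

theorem span_range_insertNth_clearLast {n k : ℕ} {A : Matrix (Fin (k + 1)) (Fin (n + 1)) F}
    {i : Fin (k + 1)} (hi : A i (Fin.last n) ≠ 0) :
    (Submodule.span F (Set.range (clearLast A i))).map (appendZero F n) ⊔
      Submodule.span F {(A i (Fin.last n))⁻¹ • A i} = Submodule.span F (Set.range A) := by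
  have hrow : ∀ r, appendZero F n (clearLast A i r) =
      A (i.succAbove r) - A (i.succAbove r) (Fin.last n) • ((A i (Fin.last n))⁻¹ • A i) := by
    intro r
    ext c
    refine Fin.lastCases ?_ (fun c => ?_) c
    · simp [appendZero_apply, hi]
    · simp [appendZero_apply, clearLast]
  rw [show (Submodule.span F (Set.range (clearLast A i))).map (appendZero F n) = _ from
    map_span_range (appendZero F n) fun r => clearLast A i r]
  apply le_antisymm
  · refine sup_le (Submodule.span_le.2 ?_) (Submodule.span_le.2 ?_)
    · rintro _ ⟨r, rfl⟩
      beta_reduce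
      rw [hrow]
      exact sub_mem (Submodule.subset_span ⟨_, rfl⟩)
        (Submodule.smul_mem _ _ (Submodule.smul_mem _ _ (Submodule.subset_span ⟨_, rfl⟩)))
    · rintro _ rfl
      exact Submodule.smul_mem _ _ (Submodule.subset_span ⟨_, rfl⟩)
  · rw [Submodule.span_le]
    rintro _ ⟨r, rfl⟩
    have hv : (A i (Fin.last n))⁻¹ • A i ∈ Submodule.span F
        (Set.range fun r => appendZero F n (clearLast A i r)) ⊔
        Submodule.span F {(A i (Fin.last n))⁻¹ • A i} :=
      Submodule.mem_sup_right (Submodule.mem_span_singleton_self _)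
    rcases Fin.eq_self_or_eq_succAbove i r with rfl | ⟨a, rfl⟩
    · have := Submodule.smul_mem _ (A r (Fin.last n)) hv
      rwa [smul_smul, mul_inv_cancel₀ hi, one_smul] at this
    · have h1 := hrow a
      rw [eq_sub_iff_add_eq] at h1
      rw [← h1]
      exact add_mem (Submodule.mem_sup_left (Submodule.subset_span ⟨a, rfl⟩))
        (Submodule.smul_mem _ _ hv)

theorem isLeadingEntry_smul {n k : ℕ} {A B : Matrix (Fin k) (Fin n) F} {r : Fin k} {c : Fin n}
    {a : F} (ha : a ≠ 0) (h : A r = a • B r) : A.IsLeadingEntry r c ↔ B.IsLeadingEntry r c := by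
  simp [Matrix.IsLeadingEntry, h, ha]

theorem canonical_of_last_eq_zero [DecidableEq F] {n k : ℕ}
    {A : Matrix (Fin (k + 1)) (Fin (n + 1)) F} (h : ∀ i, A i (Fin.last n) = 0) :
    canonical (n + 1) (k + 1) A =
      fun i => Fin.snoc (canonical n (k + 1) (A.submatrix id Fin.castSucc) i) (0 : F) := by
  rw [canonical]
  exact if_pos h

theorem canonical_of_last_ne_zero [DecidableEq F] {n k : ℕ}
    {A : Matrix (Fin (k + 1)) (Fin (n + 1)) F} (h : ¬ ∀ i, A i (Fin.last n) = 0) :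
    canonical (n + 1) (k + 1) A = (bottomRow A).insertNth (α := fun _ => Fin (n + 1) → F)
      ((A (bottomRow A) (Fin.last n))⁻¹ • A (bottomRow A))
      fun r => Fin.snoc (canonical n k (clearLast A (bottomRow A)) r) (0 : F) := by
  rw [canonical]
  exact if_neg h

/-- The third clause drives the induction: a leading column of the smaller canonical matrix is one
of the cleared matrix, hence one of `A`, and there reducedness makes the row `i` vanish. -/
theorem canonical_spec [DecidableEq F] {n k : ℕ} {A : Matrix (Fin k) (Fin n) F}
    (hA : IsReduced A) :
    IsCanonical n k (canonical n k A) ∧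
      Submodule.span F (Set.range (canonical n k A)) = Submodule.span F (Set.range A) ∧
      ∀ r c, (canonical n k A).IsLeadingEntry r c ↔ A.IsLeadingEntry r c := by
  induction n generalizing k with
  | zero =>
    cases k with
    | zero => exact ⟨trivial, rfl, fun r => r.elim0⟩
    | succ k => exact (hA.exists_lead 0).choose.elim0
  | succ n ih =>
    cases k with
    | zero => exact ⟨trivial, rfl, fun r => r.elim0⟩
    | succ k =>
      by_cases h : ∀ i, A i (Fin.last n) = 0
      · obtain ⟨h1, h2, h3⟩ := ih (hA.submatrix_castSucc h)
        rw [canonical_of_last_eq_zero h]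
        set Z := canonical n (k + 1) (A.submatrix id Fin.castSucc) with hZ
        set Y : Matrix (Fin (k + 1)) (Fin (n + 1)) F := fun i => Fin.snoc (Z i) (0 : F) with hY
        have hY0 : ∀ i, Y i (Fin.last n) = 0 := fun i => by simp [hY]
        have hYZ : Y.submatrix id Fin.castSucc = Z := by
          ext i c
          change (Fin.snoc (Z i) (0 : F) : Fin (n + 1) → F) c.castSucc = _
          simp
        refine ⟨Or.inl ⟨hY0, hYZ.symm ▸ h1⟩, ?_, fun r c => ?_⟩
        · rw [span_range_of_last_eq_zero hY0, hYZ, h2, ← span_range_of_last_eq_zero h]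
        · refine Fin.lastCases ?_ (fun c => ?_) c
          · exact ⟨fun h' => absurd (hY0 r) h'.2, fun h' => absurd (h r) h'.2⟩
          · have e := isLeadingEntry_submatrix_castSucc (A := Y) (f := id) (r := r) (c := c)
            rw [hYZ, h3, isLeadingEntry_submatrix_castSucc] at e
            exact e.symm
      · obtain ⟨hi, h0⟩ := bottomRow_spec h
        rw [canonical_of_last_ne_zero h]
        generalize bottomRow A = i at *
        obtain ⟨h1, h2, h3⟩ := ih (hA.clearLast h0)
        set Z := canonical n k (clearLast A i) with hZ
        set Y : Matrix (Fin (k + 1)) (Fin (n + 1)) F :=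
          i.insertNth (α := fun _ => Fin (n + 1) → F) ((A i (Fin.last n))⁻¹ • A i)
            fun r => Fin.snoc (Z r) (0 : F) with hY
        have hYi : Y i = (A i (Fin.last n))⁻¹ • A i := by simp [hY]
        have hY0 : ∀ r, Y (i.succAbove r) (Fin.last n) = 0 := fun i => by simp [hY]
        have hYZ : Y.submatrix i.succAbove Fin.castSucc = Z := by
          ext r c
          change Y (i.succAbove r) c.castSucc = _
          rw [show Y (i.succAbove r) = Fin.snoc (Z r) (0 : F) by simp [hY]]
          simp
        refine ⟨Or.inr ⟨i, ?_, hY0, ?_, hYZ.symm ▸ h1⟩, ?_, fun r c => ?_⟩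
        · simp [hYi, hi]
        · intro r c hrc
          rw [hYZ, h3, isLeadingEntry_clearLast_iff hA h0] at hrc
          simp [hYi, hA.eq_zero hrc (Fin.succAbove_ne i r).symm]
        · rw [span_range_of_succAbove_last_eq_zero i hY0, hYZ, h2, hYi,
            span_range_insertNth_clearLast hi]
        · rcases Fin.eq_self_or_eq_succAbove i r with rfl | ⟨a, rfl⟩
          · exact isLeadingEntry_smul (inv_ne_zero hi) hYi
          · refine Fin.lastCases ?_ (fun c => ?_) c
            · refine ⟨fun h' => absurd (hY0 a) h'.2, fun h' => ?_⟩
              obtain ⟨c', e, -⟩ := isLeadingEntry_clearLast hA h0 h'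
              exact absurd e (Fin.castSucc_ne_last c')
            · rw [← isLeadingEntry_submatrix_castSucc (A := Y) (f := i.succAbove), hYZ, h3,
                isLeadingEntry_clearLast_iff hA h0]

/-! ### One step of decoding, and decoding as the inverse of encoding. -/

/-- The value of the decoding function after a column that holds the last entry of a row. -/
def decodeStep (q m i D j : ℕ) : ℕ :=
  gauss q (if q ^ (m - i) * D + j = 0 then m + 1 else m) (i + 1) + (q ^ (m - i) * D + j) - 1

/-- In the wrapped case the residue is `q ^ (m - i) * gauss q m i - 1`, which Pascal's rule merges
with `gauss q m (i + 1)` into `gauss q (m + 1) (i + 1) - 1`. No reduction is left to compute. -/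
theorem decodeStep_eq {q m i D j : ℕ} (hq : 2 ≤ q) (hi : i ≤ m) (hD : D < gauss q m i)
    (hj : j < q ^ (m - i)) : decodeStep q m i D j = gauss q m (i + 1) +
      (((q : ℤ) ^ (m - i) * D - 1 + j) % ((q : ℤ) ^ (m - i) * gauss q m i)).toNat := by
  have h := toNat_mod_eq hD hj
  push_cast at h
  rw [h, decodeStep]
  have h0 : 0 < q ^ (m - i) * gauss q m i := mul_pos (pow_pos (by omega) _) (gauss_pos hq hi)
  split_ifs with hX
  · rw [gauss_pascal hq hi]
    omega
  · omega

theorem two_le_of_equiv {q : ℕ} (ρ : F ≃ Fin q) : 2 ≤ q := by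
  have h : ρ 0 ≠ ρ 1 := ρ.injective.ne zero_ne_one
  have h0 := (ρ 0).2
  have h1 := (ρ 1).2
  have := Fin.val_ne_of_ne h
  omega

theorem symbols_apply {F : Type*} {q : ℕ} (ρ : F ≃ Fin q) {n k : ℕ} (A : Matrix (Fin k) (Fin n) F)
    (r : Fin k) (c : Fin n) : symbols ρ A r c = ρ (A r c) := by
  simp [symbols]

theorem symbols_eq_zero_iff {q : ℕ} (ρ : F ≃ Fin q) {n k : ℕ} (A : Matrix (Fin k) (Fin n) F)
    (r : Fin k) (c : Fin n) : symbols ρ A r c = ρ 0 ↔ A r c = 0 := by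
  rw [symbols_apply, ← Fin.ext_iff, ρ.injective.eq_iff]

theorem symbols_lt {q : ℕ} (ρ : F ≃ Fin q) {n k : ℕ} (A : Matrix (Fin k) (Fin n) F) (r c : ℕ) :
    symbols ρ A r c < q := by
  have := (ρ 0).2
  unfold symbols
  split_ifs
  · exact Fin.is_lt _
  · omega

theorem packOutside_congr {q : ℕ} {L : Finset ℕ} {d d' : ℕ → ℕ} {m : ℕ}
    (h : ∀ c < m, d c = d' c) : packOutside q L d m = packOutside q L d' m :=
  Finset.sum_congr rfl fun c hc => by
    rw [h c (Finset.mem_range.1 (Finset.mem_sdiff.1 hc).1)]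

theorem map_val_subset_range {n : ℕ} (L : Finset (Fin n)) :
    L.map Fin.valEmbedding ⊆ Finset.range n := fun x hx => by
  obtain ⟨a, -, rfl⟩ := Finset.mem_map.1 hx
  exact Finset.mem_range.2 a.2

theorem posBelow_leadCols [DecidableEq F] {n k : ℕ} {A : Matrix (Fin k) (Fin n) F}
    (h : HasDistinctLeads A) : posBelow ((leadCols A).map Fin.valEmbedding) n = n - k := by
  rw [posBelow_of_subset (map_val_subset_range _), Finset.card_map, h.card_leadCols]

theorem decode_self [DecidableEq F] {q : ℕ} (ρ : F ≃ Fin q) {n : ℕ}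
    (A : Matrix (Fin n) (Fin n) F) : decode ρ n n A = 0 := by
  cases n <;> simp [decode]

theorem decode_zero [DecidableEq F] {q : ℕ} (ρ : F ≃ Fin q) {n : ℕ}
    (A : Matrix (Fin 0) (Fin n) F) : decode ρ n 0 A = 0 := by
  cases n <;> simp [decode]

theorem decode_of_last_eq_zero [DecidableEq F] {q : ℕ} (ρ : F ≃ Fin q) {n k : ℕ} (hk : k ≤ n)
    {A : Matrix (Fin k) (Fin (n + 1)) F} (h : ∀ i, A i (Fin.last n) = 0) :
    decode ρ (n + 1) k A = decode ρ n k (A.submatrix id Fin.castSucc) := by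
  cases k with
  | zero => rw [decode_zero, decode_zero]
  | succ k =>
    rw [decode, if_neg (by omega)]
    exact if_pos h

theorem decode_of_last_ne_zero [DecidableEq F] {q : ℕ} (ρ : F ≃ Fin q) {n k : ℕ}
    {A : Matrix (Fin (k + 1)) (Fin (n + 1)) F} {i : Fin (k + 1)} (hi : A i (Fin.last n) ≠ 0)
    (h : ∀ r, A (i.succAbove r) (Fin.last n) = 0)
    (hB : HasDistinctLeads (A.submatrix i.succAbove Fin.castSucc))
    (hk : k ≤ n) (hD : decode ρ n k (A.submatrix i.succAbove Fin.castSucc) < gauss q n k) :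
    decode ρ (n + 1) (k + 1) A =
      decodeStep q n k (decode ρ n k (A.submatrix i.succAbove Fin.castSucc))
        (packOutside q ((leadCols (A.submatrix i.succAbove Fin.castSucc)).map Fin.valEmbedding)
          (symbols ρ A i) n) := by
  have hq := two_le_of_equiv ρ
  have hj := packOutside_lt (L := (leadCols (A.submatrix i.succAbove Fin.castSucc)).map
    Fin.valEmbedding) (symbols_lt ρ A i) n
  rw [posBelow_leadCols hB] at hj
  rcases hk.eq_or_lt with rfl | hk'
  -- A square matrix decodes to `0` by convention, but `decodeStep` agrees: `D` and `j` are `0`,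
  -- which leaves a Gaussian coefficient with equal indices, minus `1`. So the program needs no
  -- separate case.
  · rw [decode_self, decode_self, decodeStep]
    rw [Nat.sub_self, pow_zero, Nat.lt_one_iff] at hj
    simp [hj, gauss_self hq]
  · rw [decodeStep_eq hq hk hD hj, decode, if_neg hk'.ne]
    refine (if_neg fun h' => hi (h' i)).trans ?_
    rw [bottomRow_eq hi h]
    dsimp only
    rw [← sum_compl_eq_packOutside]
    congr! 7 with c
    rw [← symbols_apply]; rfl

theorem encode_top [DecidableEq F] {q : ℕ} (ρ : F ≃ Fin q) {n : ℕ} (m : ℕ) :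
    encode ρ n n m = ⊤ := by
  cases n with
  | zero => rw [encode]; exact Subsingleton.elim _ _
  | succ n => simp [encode]

/-- The digits record only the entries outside `L`; the remaining ones are forced by `hi` and `hL`.
-/
theorem newVector_eq [DecidableEq F] {q : ℕ} (ρ : F ≃ Fin q) {n k : ℕ}
    {A : Matrix (Fin k) (Fin (n + 1)) F} {i : Fin k} (hi : A i (Fin.last n) = 1)
    {L : Finset (Fin n)} (hL : ∀ c ∈ L, A i c.castSucc = 0) :
    newVector ρ L (packOutside q (L.map Fin.valEmbedding) (symbols ρ A i) n) = A i := by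
  ext c
  refine Fin.lastCases ?_ (fun c => ?_) c
  · simp [newVector, hi]
  · rw [newVector, Fin.snoc_castSucc]
    split_ifs with h
    · exact (hL c h).symm
    · rw [Equiv.symm_apply_eq, Fin.ext_iff]
      dsimp only
      rw [posOutside_eq_posBelow, packOutside_digit (symbols_lt ρ A i) c.2, ← symbols_apply]
      · rfl
      · rw [Finset.mem_map]
        rintro ⟨x, hx, e⟩
        exact h (Fin.ext e ▸ hx)

theorem encode_decodeStep {q : ℕ} (ρ : F ≃ Fin q) {n k D j : ℕ} (hk : k < n)
    (hD : D < gauss q n k) (hj : j < q ^ (n - k)) :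
    encode ρ (n + 1) (k + 1) (decodeStep q n k D j) =
      (encode ρ n k D).map (appendZero F n) ⊔
        Submodule.span F {newVector ρ (leadColsOf (encode ρ n k D)) j} := by
  have hq := two_le_of_equiv ρ
  have hQ : 0 < q ^ (n - k) := pow_pos (by omega) _
  have h := toNat_mod_eq hD hj
  push_cast at h
  rw [decodeStep_eq hq hk.le hD hj, h, encode, if_neg hk.ne, if_neg (by omega)]
  dsimp only
  rw [Nat.add_sub_cancel_left]
  -- The encoder's `t` is `X` itself, or the full modulus if `X = 0`. In the latter case the
  -- quotient is `gauss q n k`, which the encoder's reduction sends to `0`.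
  have key : ∀ t, t = (if q ^ (n - k) * D + j = 0 then q ^ (n - k) * gauss q n k - 1
      else q ^ (n - k) * D + j - 1) + 1 →
      t / q ^ (n - k) % gauss q n k = D ∧ t % q ^ (n - k) = j := by
    rintro t rfl
    split_ifs with h0
    · have : 0 < q ^ (n - k) * gauss q n k := mul_pos hQ (gauss_pos hq hk.le)
      rw [Nat.sub_add_cancel this, Nat.mul_div_cancel_left _ hQ]
      have hD0 : D = 0 := by
        rcases Nat.eq_zero_or_pos D with h | h
        · exact h
        · have := mul_pos hQ h; omega
      simp [hD0]; omega
    · rw [Nat.sub_add_cancel (by omega), Nat.mul_add_div hQ, Nat.div_eq_of_lt hj, add_zero,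
        Nat.mod_eq_of_lt hD, Nat.mul_add_mod, Nat.mod_eq_of_lt hj]
      exact ⟨rfl, rfl⟩
  obtain ⟨h1, h2⟩ := key _ rfl
  rw [h1, h2]

theorem decode_spec [DecidableEq F] {q : ℕ} (ρ : F ≃ Fin q) {n k : ℕ}
    {A : Matrix (Fin k) (Fin n) F} (hA : IsCanonical n k A) :
    decode ρ n k A < gauss q n k ∧
      encode ρ n k (decode ρ n k A) = Submodule.span F (Set.range A) := by
  have hq := two_le_of_equiv ρ
  rcases hA.le.eq_or_lt with rfl | hkn
  · rw [encode_top, decode_self, gauss_self hq, hA.hasDistinctLeads.span_eq_top]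
    exact ⟨one_pos, rfl⟩
  induction n generalizing k with
  | zero => omega
  | succ n ih =>
    cases k with
    | zero =>
      rw [decode_zero, gauss_zero_right, encode]
      refine ⟨one_pos, ?_⟩
      rw [show Set.range A = ∅ from Set.range_eq_empty _, Submodule.span_empty]
    | succ k =>
      -- After the last column is removed the matrix may be square, a case that `ih` excludes.
      have ih' : ∀ {k : ℕ} {A : Matrix (Fin k) (Fin n) F}, IsCanonical n k A →
          decode ρ n k A < gauss q n k ∧
          encode ρ n k (decode ρ n k A) = Submodule.span F (Set.range A) := by
        intro k A hA
        rcases hA.le.eq_or_lt with rfl | hkn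
        · rw [encode_top, decode_self, gauss_self hq, hA.hasDistinctLeads.span_eq_top]
          exact ⟨one_pos, rfl⟩
        · exact ih hA hkn
      rcases hA with ⟨h0, hA⟩ | ⟨i, hi, h0, hL, hA⟩
      · obtain ⟨h1, h2⟩ := ih' hA
        rw [decode_of_last_eq_zero ρ hA.le h0, gauss_pascal hq (by omega)]
        refine ⟨by omega, ?_⟩
        rw [encode, if_neg (by omega), if_pos h1, h2, ← span_range_of_last_eq_zero h0]
      · obtain ⟨h1, h2⟩ := ih' hA
        have hB := hA.hasDistinctLeads
        have hj := packOutside_lt (L := (leadCols (A.submatrix i.succAbove Fin.castSucc)).map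
          Fin.valEmbedding) (symbols_lt ρ A i) n
        rw [posBelow_leadCols hB] at hj
        rw [decode_of_last_ne_zero ρ (by simp [hi]) h0 hB (by omega) h1]
        refine ⟨?_, ?_⟩
        · have hp : 0 < q ^ (n - k) * gauss q n k :=
            mul_pos (pow_pos (by omega) _) (gauss_pos hq (by omega))
          rw [decodeStep_eq hq (by omega) h1 hj, gauss_pascal hq (by omega)]
          have := Int.emod_lt_of_pos ((q : ℤ) ^ (n - k) *
            decode ρ n k (A.submatrix i.succAbove Fin.castSucc) - 1 +
            packOutside q ((leadCols (A.submatrix i.succAbove Fin.castSucc)).map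
              Fin.valEmbedding) (symbols ρ A i) n)
            (show 0 < (q : ℤ) ^ (n - k) * gauss q n k by exact_mod_cast hp)
          zify
          rw [Int.toNat_of_nonneg (Int.emod_nonneg _ (by exact_mod_cast hp.ne'))]
          linarith
        · rw [encode_decodeStep ρ (by omega) h1 hj, h2, hB.leadColsOf_span,
            newVector_eq ρ hi, ← span_range_of_succAbove_last_eq_zero i h0]
          intro c hc
          obtain ⟨r, hr⟩ := (Finset.mem_filter.1 hc).2
          exact hL r c hr

/-! ### The recursion of the decoding function, reversed. -/

/-- The column `m` holds the last entry of the row `r` that differs from `z`. -/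
def EndsAt (inp : ℕ → ℕ → ℕ) (n z r m : ℕ) : Prop :=
  inp r m ≠ z ∧ ∀ c, m < c → c < n → inp r c = z

/-- The column `l` holds the first entry of the row `r` that differs from `z`. -/
def LeadsAt (inp : ℕ → ℕ → ℕ) (z r l : ℕ) : Prop :=
  inp r l ≠ z ∧ ∀ c < l, inp r c = z

theorem LeadsAt.unique {inp : ℕ → ℕ → ℕ} {z r l l' : ℕ} (h : LeadsAt inp z r l)
    (h' : LeadsAt inp z r l') : l = l' :=
  le_antisymm (not_lt.1 fun hl => h'.1 (h.2 _ hl)) (not_lt.1 fun hl => h.1 (h'.2 _ hl))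

/-- The decoding function, computed column by column: `Trace q n k z inp m i L D` says that `i` rows
end in the first `m` columns, that `L` is the set of columns of their leading entries, and that `D`
is the value of the decoding function for these rows. -/
inductive Trace (q n k z : ℕ) (inp : ℕ → ℕ → ℕ) : ℕ → ℕ → Finset ℕ → ℕ → Prop
  | zero : Trace q n k z inp 0 0 ∅ 0
  | skip {m i D : ℕ} {L : Finset ℕ} (h : Trace q n k z inp m i L D)
      (hr : ∀ r < k, ¬ EndsAt inp n z r m) : Trace q n k z inp (m + 1) i L D
  | row {m i D r l : ℕ} {L : Finset ℕ} (h : Trace q n k z inp m i L D) (hrk : r < k)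
      (hr : EndsAt inp n z r m) (huniq : ∀ r' < k, EndsAt inp n z r' m → r' = r)
      (hl : LeadsAt inp z r l) (hlm : l ≤ m) (hlL : l ∉ L) (hik : i < k) (hD : D < gauss q m i) :
      Trace q n k z inp (m + 1) (i + 1) (insert l L)
        (decodeStep q m i D (packOutside q L (inp r) m))

theorem Trace.subset_and_card {q n k z m i D : ℕ} {inp : ℕ → ℕ → ℕ} {L : Finset ℕ}
    (h : Trace q n k z inp m i L D) : L ⊆ Finset.range m ∧ L.card = i := by
  induction h with
  | zero => simp
  | skip h hr ih =>
    exact ⟨ih.1.trans (Finset.range_subset_range.2 (Nat.le_succ _)), ih.2⟩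
  | row h hrk hr hu hl hlm hlL hik hD ih =>
    refine ⟨Finset.insert_subset (by simp; omega)
      (ih.1.trans (Finset.range_subset_range.2 (Nat.le_succ _))), ?_⟩
    rw [Finset.card_insert_of_notMem hlL, ih.2]

theorem Trace.le {q n k z m i D : ℕ} {inp : ℕ → ℕ → ℕ} {L : Finset ℕ}
    (h : Trace q n k z inp m i L D) : i ≤ m := by
  obtain ⟨h1, h2⟩ := h.subset_and_card
  simpa [h2] using Finset.card_le_card h1

theorem Trace.posBelow {q n k z m i D : ℕ} {inp : ℕ → ℕ → ℕ} {L : Finset ℕ}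
    (h : Trace q n k z inp m i L D) : posBelow L m = m - i := by
  obtain ⟨h1, h2⟩ := h.subset_and_card
  rw [posBelow_of_subset h1, h2]

theorem leadCols_map_of_last_eq_zero [DecidableEq F] {n k : ℕ} {A : Matrix (Fin k) (Fin (n + 1)) F}
    (h : ∀ i, A i (Fin.last n) = 0) :
    (leadCols A).map Fin.valEmbedding =
      (leadCols (A.submatrix id Fin.castSucc)).map Fin.valEmbedding := by
  ext x
  simp only [leadCols, Finset.mem_map, Finset.mem_filter, Finset.mem_univ, true_and,
    Fin.valEmbedding_apply]
  constructor
  · rintro ⟨c, ⟨r, hr⟩, rfl⟩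
    refine Fin.lastCases (fun hr => absurd (h r) hr.2) (fun c hr => ?_) c hr
    exact ⟨c, ⟨r, isLeadingEntry_submatrix_castSucc.2 hr⟩, rfl⟩
  · rintro ⟨c, ⟨r, hr⟩, rfl⟩
    exact ⟨c.castSucc, ⟨r, isLeadingEntry_submatrix_castSucc.1 hr⟩, rfl⟩

theorem leadCols_map_of_succAbove [DecidableEq F] {n k : ℕ} {A : Matrix (Fin (k + 1)) (Fin (n + 1)) F}
    {i : Fin (k + 1)} (h : ∀ r, A (i.succAbove r) (Fin.last n) = 0) {l : Fin (n + 1)}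
    (hl : A.IsLeadingEntry i l) :
    (leadCols A).map Fin.valEmbedding = insert (l : ℕ)
      ((leadCols (A.submatrix i.succAbove Fin.castSucc)).map Fin.valEmbedding) := by
  ext x
  simp only [leadCols, Finset.mem_map, Finset.mem_filter, Finset.mem_univ, true_and,
    Fin.valEmbedding_apply, Finset.mem_insert]
  constructor
  · rintro ⟨c, ⟨r, hr⟩, rfl⟩
    rcases Fin.eq_self_or_eq_succAbove i r with rfl | ⟨a, rfl⟩
    · exact Or.inl (by rw [hr.unique hl])
    · refine Or.inr (Fin.lastCases (fun hr => absurd (h a) hr.2) (fun c hr => ?_) c hr)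
      exact ⟨c, ⟨a, isLeadingEntry_submatrix_castSucc.2 hr⟩, rfl⟩
  · rintro (rfl | ⟨c, ⟨r, hr⟩, rfl⟩)
    · exact ⟨l, ⟨i, hl⟩, rfl⟩
    · exact ⟨c.castSucc, ⟨_, isLeadingEntry_submatrix_castSucc.1 hr⟩, rfl⟩

/-- `B` consists of the first `m` entries of those rows `e r` of `A` that vanish from column `m` on. -/
structure IsPrefix {n k m i : ℕ} (A : Matrix (Fin k) (Fin n) F) (B : Matrix (Fin i) (Fin m) F)
    (e : Fin i → Fin k) : Prop where
  injective : Function.Injective e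
  le : m ≤ n
  eq : ∀ r c, B r c = A (e r) (c.castLE le)
  mem_range : ∀ r, r ∈ Set.range e ↔ ∀ c : Fin n, m ≤ c → A r c = 0

theorem endsAt_symbols_iff {q : ℕ} (ρ : F ≃ Fin q) {n k : ℕ} {A : Matrix (Fin k) (Fin n) F}
    {r : Fin k} {m : ℕ} (hm : m < n) : EndsAt (symbols ρ A) n (ρ 0) r m ↔
      A r ⟨m, hm⟩ ≠ 0 ∧ ∀ c : Fin n, m + 1 ≤ c → A r c = 0 := by
  rw [EndsAt]
  refine and_congr (not_congr (symbols_eq_zero_iff ρ A r ⟨m, hm⟩)) ⟨fun h c hc => ?_, fun h c hc hn => ?_⟩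
  · exact (symbols_eq_zero_iff ρ A r c).1 (h c hc c.2)
  · exact (symbols_eq_zero_iff ρ A r ⟨c, hn⟩).2 (h _ hc)

theorem IsPrefix.symbols_eq {q : ℕ} (ρ : F ≃ Fin q) {n k m i : ℕ} {A : Matrix (Fin k) (Fin n) F}
    {B : Matrix (Fin i) (Fin m) F} {e : Fin i → Fin k} (h : IsPrefix A B e) (r : Fin i) {c : ℕ}
    (hc : c < m) : symbols ρ A (e r) c = symbols ρ B r c := by
  have h1 := symbols_apply ρ B r ⟨c, hc⟩
  have h2 := symbols_apply ρ A (e r) ⟨c, hc.trans_le h.le⟩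
  rw [h.eq] at h1
  exact h2.trans h1.symm

theorem IsPrefix.exists_of_endsAt {q : ℕ} (ρ : F ≃ Fin q) {n k m i : ℕ}
    {A : Matrix (Fin k) (Fin n) F} {B : Matrix (Fin i) (Fin (m + 1)) F} {e : Fin i → Fin k}
    (h : IsPrefix A B e) {r : ℕ} (hr : r < k) (hE : EndsAt (symbols ρ A) n (ρ 0) r m) :
    ∃ a, r = e a ∧ B a (Fin.last m) ≠ 0 := by
  obtain ⟨h1, h2⟩ := (endsAt_symbols_iff ρ (r := ⟨r, hr⟩) h.le).1 hE
  obtain ⟨a, ha⟩ := (h.mem_range _).2 h2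
  refine ⟨a, by rw [ha], ?_⟩
  rw [h.eq, ha]
  exact h1

theorem IsPrefix.endsAt {q : ℕ} (ρ : F ≃ Fin q) {n k m i : ℕ}
    {A : Matrix (Fin k) (Fin n) F} {B : Matrix (Fin i) (Fin (m + 1)) F} {e : Fin i → Fin k}
    (h : IsPrefix A B e) {a : Fin i} (ha : B a (Fin.last m) ≠ 0) :
    EndsAt (symbols ρ A) n (ρ 0) (e a) m :=
  (endsAt_symbols_iff ρ h.le).2 ⟨by rw [h.eq] at ha; exact ha, (h.mem_range _).1 ⟨a, rfl⟩⟩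

theorem IsPrefix.mem_range_castSucc {n k m i : ℕ}
    {A : Matrix (Fin k) (Fin n) F} {B : Matrix (Fin i) (Fin (m + 1)) F} {e : Fin i → Fin k}
    (h : IsPrefix A B e) (r : Fin k) :
    (∃ a, e a = r ∧ B a (Fin.last m) = 0) ↔ ∀ c : Fin n, m ≤ c → A r c = 0 := by
  constructor
  · rintro ⟨a, rfl, ha⟩ c hc
    rcases hc.eq_or_lt with hc | hc
    · rw [h.eq] at ha
      convert ha using 2
      exact Fin.ext hc.symm
    · exact (h.mem_range _).1 ⟨a, rfl⟩ c hc
  · intro h0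
    obtain ⟨a, rfl⟩ := (h.mem_range r).2 fun c hc => h0 c (by omega)
    exact ⟨a, rfl, by rw [h.eq]; exact h0 _ le_rfl⟩

/-- `decode` deletes columns from the right, each with at most one row. The rows left at column `m`
are exactly those of `A` that vanish from `m` on. Hence a left-to-right scan of the fixed matrix `A`
meets the same sub-matrices, and the program never has to modify its input. -/
theorem trace_of_isPrefix [DecidableEq F] {q : ℕ} (ρ : F ≃ Fin q) {n k m i : ℕ} {A : Matrix (Fin k) (Fin n) F}
    {B : Matrix (Fin i) (Fin m) F} {e : Fin i → Fin k} (h : IsPrefix A B e)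
    (hB : IsCanonical m i B) :
    Trace q n k (ρ 0) (symbols ρ A) m i ((leadCols B).map Fin.valEmbedding) (decode ρ m i B) := by
  induction m generalizing i with
  | zero =>
    cases i with
    | zero =>
      rw [decode_zero, show leadCols B = ∅ from Finset.eq_empty_of_isEmpty _, Finset.map_empty]
      exact Trace.zero
    | succ i => exact hB.elim
  | succ m ih =>
    have hskip : (∀ a, B a (Fin.last m) = 0) → IsCanonical m i (B.submatrix id Fin.castSucc) →
        Trace q n k (ρ 0) (symbols ρ A) (m + 1) i ((leadCols B).map Fin.valEmbedding)
          (decode ρ (m + 1) i B) := by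
      intro h0 hB'
      have hP : IsPrefix A (B.submatrix id Fin.castSucc) e := by
        refine ⟨h.injective, (Nat.le_succ m).trans h.le, fun r c => h.eq r c.castSucc, fun r => ?_⟩
        rw [← h.mem_range_castSucc]
        simp [h0]
      rw [leadCols_map_of_last_eq_zero h0, decode_of_last_eq_zero ρ hB'.le h0]
      refine Trace.skip (ih hP hB') fun r hr hE => ?_
      obtain ⟨a, -, ha⟩ := h.exists_of_endsAt ρ hr hE
      exact ha (h0 a)
    cases i with
    | zero => exact hskip (fun a => a.elim0) (by cases m <;> trivial)
    | succ i =>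
      rcases hB with ⟨h0, hB'⟩ | ⟨a, ha, h0, hL, hB'⟩
      · exact hskip h0 hB'
      · have ha' : B a (Fin.last m) ≠ 0 := by simp [ha]
        have hP : IsPrefix A (B.submatrix a.succAbove Fin.castSucc) (e ∘ a.succAbove) := by
          refine ⟨h.injective.comp Fin.succAbove_right_injective, (Nat.le_succ m).trans h.le,
            fun r c => h.eq _ c.castSucc, fun r => ?_⟩
          rw [← h.mem_range_castSucc]
          constructor
          · rintro ⟨b, rfl⟩
            exact ⟨_, rfl, h0 b⟩
          · rintro ⟨b, rfl, hb⟩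
            rcases Fin.eq_self_or_eq_succAbove a b with rfl | ⟨b, rfl⟩
            · exact absurd hb ha'
            · exact ⟨b, rfl⟩
        obtain ⟨l, hl⟩ := Matrix.row_ne_zero_iff_exists_isLeadingEntry.1
          (show B a ≠ 0 from fun e => ha' (by rw [e]; rfl))
        have hlm : (l : ℕ) ≤ m := Nat.lt_succ_iff.1 l.2
        rw [leadCols_map_of_succAbove h0 hl, decode_of_last_ne_zero ρ ha' h0
          hB'.hasDistinctLeads hB'.le (decode_spec ρ hB').1,
          ← packOutside_congr fun c hc => h.symbols_eq ρ a (Nat.lt_succ_of_lt hc)]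
        refine Trace.row (ih hP hB') (e a).2 (h.endsAt ρ ha') (fun r hr hE => ?_) ⟨?_, ?_⟩ hlm ?_ ?_
          (decode_spec ρ hB').1
        · obtain ⟨b, rfl, hb⟩ := h.exists_of_endsAt ρ hr hE
          rcases Fin.eq_self_or_eq_succAbove a b with rfl | ⟨b, rfl⟩
          · rfl
          · exact absurd (h0 b) hb
        · rw [h.symbols_eq ρ a l.2]
          exact (symbols_eq_zero_iff ρ B a l).not.2 hl.2
        · intro c hc
          have hcm : c < m + 1 := hc.trans l.2
          rw [h.symbols_eq ρ a hcm]
          exact (symbols_eq_zero_iff ρ B a ⟨c, hcm⟩).2 (hl.1 _ hc)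
        · intro hmem
          obtain ⟨c, hc, hcl⟩ := Finset.mem_map.1 hmem
          obtain ⟨r, hr⟩ := (Finset.mem_filter.1 hc).2
          have := hL r c hr
          rw [show c.castSucc = l from Fin.ext hcl] at this
          exact hl.2 this
        · simpa using Fintype.card_le_of_injective e h.injective

theorem trace_of_isCanonical [DecidableEq F] {q : ℕ} (ρ : F ≃ Fin q) {n k : ℕ} {A : Matrix (Fin k) (Fin n) F}
    (hA : IsCanonical n k A) : ∃ L, Trace q n k (ρ 0) (symbols ρ A) n k L (decode ρ n k A) := by
  refine ⟨_, trace_of_isPrefix ρ (e := id) ⟨Function.injective_id, le_rfl, fun r c => rfl,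
    fun r => ?_⟩ hA⟩
  simp only [Set.range_id, Set.mem_univ, true_iff]
  intro c hc
  exact absurd c.2 hc.not_gt

/-! ### Reasoning about programs -/

section Hoare
variable {q : ℕ} {M : ℕ → ℕ} {inp : ℕ → ℕ → ℕ}

/-- The program `p`, started in `s`, halts in a state and after a time that satisfy `Q`. -/
def Halts (q : ℕ) (M : ℕ → ℕ) (inp : ℕ → ℕ → ℕ) (p : Prog) (s : State)
    (Q : State → ℕ → Prop) : Prop :=
  ∃ s' t, Exec q M inp p s s' t ∧ Q s' t

theorem Halts.mono {p : Prog} {s : State} {Q Q' : State → ℕ → Prop} (h : Halts q M inp p s Q)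
    (hQ : ∀ s' t, Q s' t → Q' s' t) : Halts q M inp p s Q' := by
  obtain ⟨s', t, h1, h2⟩ := h
  exact ⟨s', t, h1, hQ _ _ h2⟩

/-- Stated as equivalences, this rule and the next two let `simp` replace straight-line code by its
effect; only loops need an invariant. -/
theorem halts_instr {c : Instr} {s : State} {Q : State → ℕ → Prop} :
    Halts q M inp (.instr c) s Q ↔ Q (c.eff q inp s) (c.cost q M s) := by
  constructor
  · rintro ⟨s', t, h, hQ⟩
    cases h
    exact hQ
  · exact fun h => ⟨_, _, .instr c s, h⟩

theorem halts_seq {p₁ p₂ : Prog} {s : State} {Q : State → ℕ → Prop} :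
    Halts q M inp (.seq p₁ p₂) s Q ↔ Halts q M inp p₁ s fun s₁ t₁ =>
      Halts q M inp p₂ s₁ fun s₂ t₂ => Q s₂ (t₁ + t₂) := by
  constructor
  · rintro ⟨s', t, h, hQ⟩
    cases h with
    | seq h₁ h₂ => exact ⟨_, _, h₁, _, _, h₂, hQ⟩
  · rintro ⟨s₁, t₁, h₁, s₂, t₂, h₂, hQ⟩
    exact ⟨_, _, .seq h₁ h₂, hQ⟩

theorem halts_ifLt {x y : ℕ} {p₁ p₂ : Prog} {s : State} {Q : State → ℕ → Prop} :
    Halts q M inp (.ifLt x y p₁ p₂) s Q ↔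
      (s.idx x < s.idx y → Halts q M inp p₁ s fun s' t => Q s' (t + 1)) ∧
      (¬ s.idx x < s.idx y → Halts q M inp p₂ s fun s' t => Q s' (t + 1)) := by
  constructor
  · rintro ⟨s', t, h, hQ⟩
    cases h with
    | ifTrue hc h => exact ⟨fun _ => ⟨_, _, h, hQ⟩, fun h' => absurd hc h'⟩
    | ifFalse hc h => exact ⟨fun h' => absurd h' hc, fun _ => ⟨_, _, h, hQ⟩⟩
  · rintro ⟨h1, h2⟩
    by_cases hc : s.idx x < s.idx y
    · obtain ⟨s', t, h, hQ⟩ := h1 hc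
      exact ⟨_, _, .ifTrue hc h, hQ⟩
    · obtain ⟨s', t, h, hQ⟩ := h2 hc
      exact ⟨_, _, .ifFalse hc h, hQ⟩

theorem halts_whileLt_of_lt {x y : ℕ} {p : Prog} {s : State} {Q : State → ℕ → Prop}
    (hc : s.idx x < s.idx y) (h : Halts q M inp p s fun s₁ t₁ =>
      Halts q M inp (.whileLt x y p) s₁ fun s₂ t₂ => Q s₂ (t₁ + t₂ + 1)) :
    Halts q M inp (.whileLt x y p) s Q := by
  obtain ⟨s₁, t₁, h₁, s₂, t₂, h₂, hQ⟩ := h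
  exact ⟨_, _, .whileTrue hc h₁ h₂, hQ⟩

theorem halts_whileLt_of_not_lt {x y : ℕ} {p : Prog} {s : State} {Q : State → ℕ → Prop}
    (hc : ¬ s.idx x < s.idx y) (h : Q s 1) : Halts q M inp (.whileLt x y p) s Q :=
  ⟨_, _, .whileFalse hc, h⟩

/-- The bound depends on the round because the product tree multiplies numbers of different lengths
in different rounds. The induction is on the number of rounds left. -/
theorem halts_loop_sum {x y : ℕ} {p : Prog} (N : ℕ) (I : ℕ → State → Prop) (c : ℕ → ℕ) {s : State}
    (h0 : I 0 s) (hlt : ∀ j s, j ≤ N → I j s → (s.idx x < s.idx y ↔ j < N))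
    (hstep : ∀ j s, j < N → I j s → Halts q M inp p s fun s' t => I (j + 1) s' ∧ t ≤ c j) :
    Halts q M inp (.whileLt x y p) s fun s' t =>
      I N s' ∧ t ≤ ∑ j ∈ Finset.range N, (c j + 1) + 1 := by
  have key : ∀ d j s, j + d = N → I j s → Halts q M inp (.whileLt x y p) s fun s' t =>
      I N s' ∧ t + ∑ i ∈ Finset.range j, (c i + 1) ≤ ∑ i ∈ Finset.range N, (c i + 1) + 1 := by
    intro d
    induction d with
    | zero =>
      rintro j s rfl hI
      exact halts_whileLt_of_not_lt (by rw [hlt _ _ le_rfl hI]; omega) ⟨hI, by rw [add_comm]; rfl⟩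
    | succ d ih =>
      intro j s hj hI
      refine halts_whileLt_of_lt ((hlt j s (by omega) hI).2 (by omega)) ?_
      refine (hstep j s (by omega) hI).mono fun s₁ t₁ h₁ => ?_
      refine (ih (j + 1) s₁ (by omega) h₁.1).mono fun s₂ t₂ h₂ => ⟨h₂.1, ?_⟩
      have := h₂.2
      rw [Finset.sum_range_succ] at this
      have := h₁.2
      omega
  exact (key N 0 s (by omega) h0).mono fun s' t h => ⟨h.1, by simpa using h.2⟩

theorem halts_loop {x y : ℕ} {p : Prog} (N : ℕ) (I : ℕ → State → Prop) (c : ℕ) {s : State}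
    (h0 : I 0 s) (hlt : ∀ j s, j ≤ N → I j s → (s.idx x < s.idx y ↔ j < N))
    (hstep : ∀ j s, j < N → I j s → Halts q M inp p s fun s' t => I (j + 1) s' ∧ t ≤ c) :
    Halts q M inp (.whileLt x y p) s fun s' t => I N s' ∧ t ≤ N * (c + 1) + 1 :=
  (halts_loop_sum N I (fun _ => c) h0 hlt hstep).mono fun s' t h => by simpa using h

/-- If `x ≠ y` then `p`. -/
def ifNe (x y : ℕ) (p : Prog) : Prog := .ifLt x y p (.ifLt y x p (.instr (.zero 99)))

/-- One test or two are made, depending on which side is smaller, so the time is known only up to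
the bound `t + 2`; hence the quantifier over `u`. Register `99` is a dummy that the empty branch
writes and no program reads. -/
theorem halts_ifNe {x y : ℕ} {p : Prog} {s : State} {Q : State → ℕ → Prop}
    (h1 : s.idx x ≠ s.idx y →
      Halts q M inp p s fun s' t => ∀ u ≤ t + 2, Q s' u)
    (h2 : s.idx x = s.idx y → Q (s.setIdx 99 0) 3) : Halts q M inp (ifNe x y p) s Q := by
  rw [ifNe, halts_ifLt, halts_ifLt, halts_instr]
  exact ⟨fun h => (h1 h.ne).mono fun s' t h => h _ (by omega), fun h =>
    ⟨fun h' => (h1 h'.ne').mono fun s' t h => h _ (by omega), fun h' => h2 (by omega)⟩⟩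

end Hoare

namespace State

@[simp] theorem setIdx_idx (s : State) (x v y : ℕ) :
    (s.setIdx x v).idx y = if y = x then v else s.idx y := by
  simp [setIdx, Function.update_apply]
@[simp] theorem setIdx_arr (s : State) (x v : ℕ) : (s.setIdx x v).arr = s.arr := rfl
@[simp] theorem setIdx_int (s : State) (x v : ℕ) : (s.setIdx x v).int = s.int := rfl
@[simp] theorem setIdx_iarr (s : State) (x v : ℕ) : (s.setIdx x v).iarr = s.iarr := rfl

@[simp] theorem setInt_int (s : State) (x v y : ℕ) :
    (s.setInt x v).int y = if y = x then v else s.int y := by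
  simp [setInt, Function.update_apply]
@[simp] theorem setInt_arr (s : State) (x v : ℕ) : (s.setInt x v).arr = s.arr := rfl
@[simp] theorem setInt_idx (s : State) (x v : ℕ) : (s.setInt x v).idx = s.idx := rfl
@[simp] theorem setInt_iarr (s : State) (x v : ℕ) : (s.setInt x v).iarr = s.iarr := rfl

@[simp] theorem setArr_arr (s : State) (a p v b c : ℕ) :
    (s.setArr a p v).arr b c = if b = a ∧ c = p then v else s.arr b c := by
  simp only [setArr, Function.update_apply]
  split_ifs <;> simp_all
@[simp] theorem setArr_idx (s : State) (a p v : ℕ) : (s.setArr a p v).idx = s.idx := rfl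
@[simp] theorem setArr_int (s : State) (a p v : ℕ) : (s.setArr a p v).int = s.int := rfl
@[simp] theorem setArr_iarr (s : State) (a p v : ℕ) : (s.setArr a p v).iarr = s.iarr := rfl

@[simp] theorem setIArr_iarr (s : State) (a p v b c : ℕ) :
    (s.setIArr a p v).iarr b c = if b = a ∧ c = p then v else s.iarr b c := by
  simp only [setIArr, Function.update_apply]
  split_ifs <;> simp_all
@[simp] theorem setIArr_idx (s : State) (a p v : ℕ) : (s.setIArr a p v).idx = s.idx := rfl
@[simp] theorem setIArr_int (s : State) (a p v : ℕ) : (s.setIArr a p v).int = s.int := rfl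
@[simp] theorem setIArr_arr (s : State) (a p v : ℕ) : (s.setIArr a p v).arr = s.arr := rfl

end State

instance : Coe Instr Prog := ⟨Prog.instr⟩

infixr:60 " ;; " => Prog.seq

/-! ### The parts of the program -/

section Programs
open Instr Prog

variable {q : ℕ} {M : ℕ → ℕ} {inp : ℕ → ℕ → ℕ}

/-- Index register `3 := n * k`. -/
def areaProg : Prog := whileLt 20 1 (inc 20 ;; zero 21 ;; whileLt 21 0 (inc 21 ;; inc 3))

theorem halts_areaProg {s : State} (h3 : s.idx 3 = 0) (h20 : s.idx 20 = 0) :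
    Halts q M inp areaProg s fun s' t =>
      s'.idx 3 = s.idx 0 * s.idx 1 ∧ (∀ x, x ≠ 3 → (x < 20 ∨ 30 ≤ x) → s'.idx x = s.idx x) ∧
      s'.arr = s.arr ∧ s'.int = s.int ∧ s'.iarr = s.iarr ∧
      t ≤ s.idx 1 * (s.idx 0 * 3 + 4) + 1 := by
  refine (halts_loop (s.idx 1) (fun j s' => s'.idx 20 = j ∧ s'.idx 3 = s.idx 0 * j ∧
    (∀ x, x ≠ 3 → (x < 20 ∨ 30 ≤ x) → s'.idx x = s.idx x) ∧ s'.arr = s.arr ∧ s'.int = s.int ∧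
    s'.iarr = s.iarr) (s.idx 0 * 3 + 3) ⟨h20, by simp [h3], fun _ _ _ => rfl, rfl, rfl, rfl⟩ ?_ ?_).mono
      fun s' t h => ?_
  · rintro j s' - ⟨h1, -, h2, -⟩
    rw [h1, h2 1 (by omega) (by omega)]
  · rintro j s' hj ⟨h1, h2, h3, h4, h5, h6⟩
    simp only [halts_seq, halts_instr, eff, cost]
    refine (halts_loop (s.idx 0) (fun i s' => s'.idx 20 = j + 1 ∧ s'.idx 21 = i ∧
      s'.idx 3 = s.idx 0 * j + i ∧ (∀ x, x ≠ 3 → (x < 20 ∨ 30 ≤ x) → s'.idx x = s.idx x) ∧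
      s'.arr = s.arr ∧ s'.int = s.int ∧ s'.iarr = s.iarr) 2 ?_ ?_ ?_).mono fun s' t h => ?_
    · refine ⟨by simp [h1], by simp, by simp [h2], fun x hx hx' => ?_, h4, h5, h6⟩
      simp [show x ≠ 20 by omega, show x ≠ 21 by omega, h3 x hx hx']
    · rintro j s' - ⟨-, h1, -, h2, -⟩
      rw [h1, h2 0 (by omega) (by omega)]
    · rintro i s' hi ⟨h1, h2, h3, h4, h5, h6, h7⟩
      simp only [halts_seq, halts_instr, eff, cost]
      refine ⟨⟨by simp [h1], by simp [h2], by simp [h3, add_assoc], fun x hx hx' => ?_, h5, h6, h7⟩,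
        le_rfl⟩
      simp [show x ≠ 3 by omega, show x ≠ 21 by omega, h4 x hx hx']
    · obtain ⟨⟨h1, h2, h3, h4⟩, h5⟩ := h
      exact ⟨⟨h1, by rw [h3]; ring, h4⟩, by omega⟩
  · obtain ⟨⟨h1, h2, h3, h4, h5, h6⟩, h7⟩ := h
    exact ⟨h2, h3, h4, h5, h6, h7⟩

/-- Index register `21 :=` the last column of row `8` with an entry different from `z`. -/
def lastProg : Prog :=
  whileLt 20 0 (entry 22 8 20 ;; ifNe 22 2 (copy 21 20) ;; inc 20)

theorem halts_lastProg {s : State} (h20 : s.idx 20 = 0)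
    (hne : ∃ c < s.idx 0, inp (s.idx 8) c ≠ s.idx 2) :
    Halts q M inp lastProg s fun s' t =>
      s'.idx 21 < s.idx 0 ∧ EndsAt inp (s.idx 0) (s.idx 2) (s.idx 8) (s'.idx 21) ∧
      (∀ x, x < 20 ∨ (30 ≤ x ∧ x ≠ 99) → s'.idx x = s.idx x) ∧
      s'.arr = s.arr ∧ s'.int = s.int ∧ s'.iarr = s.iarr ∧ t ≤ s.idx 0 * 6 + 1 := by
  refine (halts_loop (s.idx 0) (fun j s' => s'.idx 20 = j ∧
    ((∃ c < j, inp (s.idx 8) c ≠ s.idx 2) → s'.idx 21 < j ∧ inp (s.idx 8) (s'.idx 21) ≠ s.idx 2 ∧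
      ∀ c, s'.idx 21 < c → c < j → inp (s.idx 8) c = s.idx 2) ∧
    (∀ x, x < 20 ∨ (30 ≤ x ∧ x ≠ 99) → s'.idx x = s.idx x) ∧ s'.arr = s.arr ∧ s'.int = s.int ∧
    s'.iarr = s.iarr) 5 ⟨h20, ?_, fun _ _ => rfl, rfl, rfl, rfl⟩ ?_ ?_).mono
      fun s' t h => ?_
  · rintro ⟨c, hc, -⟩; omega
  · rintro j s' - ⟨h1, -, h2, -⟩
    rw [h1, h2 0 (by omega)]
  · rintro j s' hj ⟨h1, h2, h3, h4, h5, h6⟩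
    simp only [halts_seq, halts_instr, eff, cost]
    have e2 := h3 2 (by omega)
    have e8 := h3 8 (by omega)
    refine halts_ifNe (fun hn => ?_) (fun he => ?_)
    · simp only [State.setIdx_idx, h1, e2, e8] at hn
      simp only [halts_instr, eff, cost]
      refine fun u hu => ⟨⟨by simp [h1], fun _ => ?_, fun x hx => ?_, h4, h5, h6⟩, by omega⟩
      · simp [h1]; exact ⟨by simpa using hn, fun c _ _ => by omega⟩
      · simp [show x ≠ 20 by omega, show x ≠ 21 by omega, show x ≠ 22 by omega, h3 x hx]
    · simp [h1, e2, e8] at he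
      refine ⟨⟨by simp [h1], ?_, fun x hx => ?_, h4, h5, h6⟩, by omega⟩
      · rintro ⟨c, hc, hcz⟩
        have hcj : c ≠ j := by rintro rfl; exact hcz he
        obtain ⟨g1, g2, g3⟩ := h2 ⟨c, by omega, hcz⟩
        simp
        refine ⟨by omega, g2, fun c h1 h2 => ?_⟩
        rcases eq_or_ne c j with rfl | hcj
        · exact he
        · exact g3 c h1 (by omega)
      · simp [show x ≠ 20 by omega, show x ≠ 99 by omega, show x ≠ 22 by omega, h3 x hx]
  · obtain ⟨⟨h1, h2, h3, h4, h5, h6⟩, h7⟩ := h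
    obtain ⟨g1, g2, g3⟩ := h2 hne
    exact ⟨g1, ⟨g2, g3⟩, h3, h4, h5, h6, h7⟩

theorem EndsAt.unique {n z r m m' : ℕ} (h : EndsAt inp n z r m) (h' : EndsAt inp n z r m')
    (hm : m < n) (hm' : m' < n) : m = m' :=
  le_antisymm (not_lt.1 fun hl => h.1 (h'.2 _ hl hm)) (not_lt.1 fun hl => h'.1 (h.2 _ hl hm'))

/-- Position `m` of `T` holds `r + 1` for a row `r < k` that ends in column `m`, if there is one, and
`0` otherwise. -/
def IsEndTable (inp : ℕ → ℕ → ℕ) (n z k : ℕ) (T : ℕ → ℕ) : Prop :=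
  ∀ m < n, (T m = 0 ∧ ∀ r < k, ¬ EndsAt inp n z r m) ∨ ∃ r < k, T m = r + 1 ∧ EndsAt inp n z r m

/-- Index array `0 :=` the table of the columns where the rows end. -/
def endsProg : Prog := whileLt 8 1 (zero 20 ;; lastProg ;; inc 8 ;; store 0 21 8)

theorem halts_endsProg {s : State} (h8 : s.idx 8 = 0) (h0 : ∀ m, s.arr 0 m = 0)
    (hne : ∀ r < s.idx 1, ∃ c < s.idx 0, inp r c ≠ s.idx 2) :
    Halts q M inp endsProg s fun s' t =>
      IsEndTable inp (s.idx 0) (s.idx 2) (s.idx 1) (s'.arr 0) ∧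
      (∀ x, x ≠ 8 → (x < 20 ∨ (30 ≤ x ∧ x ≠ 99)) → s'.idx x = s.idx x) ∧
      (∀ a, a ≠ 0 → s'.arr a = s.arr a) ∧ s'.int = s.int ∧ s'.iarr = s.iarr ∧
      t ≤ s.idx 1 * (s.idx 0 * 6 + 5) + 1 := by
  refine (halts_loop (s.idx 1) (fun j s' => s'.idx 8 = j ∧
    IsEndTable inp (s.idx 0) (s.idx 2) j (s'.arr 0) ∧
    (∀ x, x ≠ 8 → (x < 20 ∨ (30 ≤ x ∧ x ≠ 99)) → s'.idx x = s.idx x) ∧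
    (∀ a, a ≠ 0 → s'.arr a = s.arr a) ∧ s'.int = s.int ∧ s'.iarr = s.iarr)
    (s.idx 0 * 6 + 4) ⟨h8, ?_, fun _ _ _ => rfl, fun _ _ => rfl, rfl, rfl⟩ ?_ ?_).mono
      fun s' t h => ?_
  · exact fun m _ => Or.inl ⟨h0 m, fun r hr => by omega⟩
  · rintro j s' - ⟨h1, -, h2, -⟩
    rw [h1, h2 1 (by omega) (by omega)]
  · rintro j s' hj ⟨h1, h2, h3, h4, h5, h6⟩
    simp only [halts_seq, halts_instr, eff, cost]
    have e0 := h3 0 (by omega) (by omega)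
    have e2 := h3 2 (by omega) (by omega)
    refine (halts_lastProg (by simp) (by simpa [h1, e0, e2] using hne j hj)).mono fun s'' t h => ?_
    simp [h1, e0, e2] at h
    obtain ⟨g1, g2, g3, g4, g5, g6, g7⟩ := h
    have g8 := g3 8 (by omega)
    simp [h1] at g8
    refine ⟨⟨by simp [g8], fun m hm => ?_, fun x hx hx' => ?_, fun a ha => ?_, ?_, ?_⟩, by omega⟩
    · by_cases hm' : m = s''.idx 21
      · exact Or.inr ⟨j, by omega, by simp [hm', g8], hm' ▸ g2⟩
      · rcases h2 m hm with ⟨k1, k2⟩ | ⟨r, k1, k2, k3⟩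
        · refine Or.inl ⟨by simp [hm', g4, k1], fun r hr hE => ?_⟩
          rcases eq_or_ne r j with rfl | hrj
          · exact hm' (hE.unique g2 hm g1)
          · exact k2 r (by omega) hE
        · exact Or.inr ⟨r, by omega, by simp [hm', g4, k2], k3⟩
    · simp [hx]
      rw [g3 x hx', if_neg (by omega), h3 x hx hx']
    · ext c
      simp [ha, g4, h4 a ha]
    · simp [g5, h5]
    · simp [g6, h6]
  · obtain ⟨⟨h1, h2, h3, h4, h5, h6⟩, h7⟩ := h
    exact ⟨h2, h3, h4, h5, h6, h7⟩

/-- Index array `1` holds `1` at the positions in `L` and `0` elsewhere. -/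
def Marks (L : Finset ℕ) (s : State) : Prop := ∀ c, s.arr 1 c = if c ∈ L then 1 else 0

/-- Index array `2 :=` the symbols of row `8` below column `4` at unmarked positions, and index
register `30 :=` their number. -/
def digitsProg : Prog :=
  zero 30 ;; zero 31 ;; whileLt 31 4 (load 32 1 31 ;;
    ifLt 6 32 (zero 99) (entry 33 8 31 ;; store 2 30 33 ;; inc 30) ;; inc 31)

/-- Register `30` is at once the counter and the write address, so the symbol of an unmarked column
`c` lands at position `posBelow L c`. -/
theorem halts_digitsProg {s : State} {L : Finset ℕ} (h6 : s.idx 6 = 0) (hL : Marks L s)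
    (hd : ∀ c, inp (s.idx 8) c < q) :
    Halts q M inp digitsProg s fun s' t =>
      s'.idx 30 = posBelow L (s.idx 4) ∧
      ∑ l ∈ Finset.range (posBelow L (s.idx 4)), (s'.arr 2 l % q) * q ^ l =
        packOutside q L (inp (s.idx 8)) (s.idx 4) ∧
      (∀ x, x < 30 → s'.idx x = s.idx x) ∧ (∀ a, a ≠ 2 → s'.arr a = s.arr a) ∧
      s'.int = s.int ∧ s'.iarr = s.iarr ∧ t ≤ s.idx 4 * 7 + 3 := by
  rw [digitsProg]
  simp only [halts_seq, halts_instr, eff, cost]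
  refine (halts_loop (s.idx 4) (fun j s' => s'.idx 31 = j ∧ s'.idx 30 = posBelow L j ∧
    ∑ l ∈ Finset.range (posBelow L j), (s'.arr 2 l % q) * q ^ l =
        packOutside q L (inp (s.idx 8)) j ∧
      (∀ x, x < 30 → s'.idx x = s.idx x) ∧ (∀ a, a ≠ 2 → s'.arr a = s.arr a) ∧
      s'.int = s.int ∧ s'.iarr = s.iarr) 6 ?_ ?_ ?_).mono fun s' t h => ?_
  · refine ⟨by simp, by simp [posBelow], by simp [posBelow, packOutside], fun x hx => ?_,
      by simp, by simp, by simp⟩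
    simp [show x ≠ 30 by omega, show x ≠ 31 by omega]
  · rintro j s' - ⟨h1, -, -, h2, -⟩
    rw [h1, h2 4 (by omega)]
  · rintro j s' hj ⟨h1, h2, h3, h4, h5, hi, hia⟩
    have e1 : s'.arr 1 j = if j ∈ L then 1 else 0 := by rw [h5 1 (by omega)]; exact hL j
    have e6 : s'.idx 6 = 0 := by rw [h4 6 (by omega), h6]
    have e8 : s'.idx 8 = s.idx 8 := h4 8 (by omega)
    simp only [halts_seq, halts_instr, halts_ifLt, eff, cost]
    simp only [State.setIdx_idx, State.setIdx_arr, h1, e1, e6]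
    by_cases hjL : j ∈ L
    · refine ⟨fun _ => ?_, fun h => absurd h (by simp [hjL])⟩
      refine ⟨⟨by simp, by simp [h2, posBelow_succ_of_mem hjL],
        by simpa [posBelow_succ_of_mem hjL, packOutside_succ_of_mem hjL] using h3, fun x hx => ?_,
        by simpa using h5, by simpa using hi, by simpa using hia⟩, by omega⟩
      simp [show x ≠ 99 by omega, show x ≠ 31 by omega, show x ≠ 32 by omega, h4 x hx]
    · refine ⟨fun h => absurd h (by simp [hjL]), fun _ => ?_⟩
      refine ⟨⟨by simp [h1], by simp [h2, posBelow_succ_of_notMem hjL], ?_, fun x hx => ?_,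
        fun a ha => ?_, by simpa using hi, by simpa using hia⟩, by omega⟩
      · rw [posBelow_succ_of_notMem hjL, packOutside_succ_of_notMem hjL, Finset.sum_range_succ,
          ← h3]
        congr 1
        · refine Finset.sum_congr rfl fun l hl => ?_
          have : l ≠ posBelow L j := (Finset.mem_range.1 hl).ne
          simp [h2, this]
        · simp [h2, e8, Nat.mod_eq_of_lt (hd j)]
      · simp [show x ≠ 30 by omega, show x ≠ 31 by omega, show x ≠ 32 by omega,
          show x ≠ 33 by omega, h4 x hx]
      · ext c; simp [ha, h5 a ha]
  · obtain ⟨⟨h1, h2, h3, h4, h5, h6, h7⟩, h8⟩ := h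
    exact ⟨h2, h3, h4, h5, h6, h7, by omega⟩

/-- Index register `42 :=` the column of the leading entry of row `8`, which ends in column `4`. -/
def leadProg : Prog :=
  copy 40 4 ;; inc 40 ;; whileLt 6 40 (dec 40 ;; entry 41 8 40 ;; ifNe 41 2 (copy 42 40))

/-- The scan runs from right to left and overwrites register `42`, so the leftmost entry different
from the zero symbol survives. The first entry visited is of this kind, so the invariant may be
silent before the first round. -/
theorem halts_leadProg {s : State} (h6 : s.idx 6 = 0) (hne : inp (s.idx 8) (s.idx 4) ≠ s.idx 2) :
    Halts q M inp leadProg s fun s' t =>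
      LeadsAt inp (s.idx 2) (s.idx 8) (s'.idx 42) ∧
      (∀ x, x < 40 → s'.idx x = s.idx x) ∧ s'.arr = s.arr ∧
      s'.int = s.int ∧ s'.iarr = s.iarr ∧ t ≤ s.idx 4 * 6 + 9 := by
  rw [leadProg]
  simp only [halts_seq, halts_instr, eff, cost]
  refine (halts_loop (s.idx 4 + 1) (fun j s' => s'.idx 40 = s.idx 4 + 1 - j ∧
    (1 ≤ j → inp (s.idx 8) (s'.idx 42) ≠ s.idx 2 ∧
      ∀ c, s.idx 4 + 1 - j ≤ c → c < s'.idx 42 → inp (s.idx 8) c = s.idx 2) ∧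
      (∀ x, x < 40 → s'.idx x = s.idx x) ∧ s'.arr = s.arr ∧
      s'.int = s.int ∧ s'.iarr = s.iarr) 5 ?_ ?_ ?_).mono fun s' t h => ?_
  · refine ⟨by simp, by simp, fun x hx => ?_, rfl, rfl, rfl⟩
    simp [show x ≠ 40 by omega]
  · rintro j s' - ⟨h1, -, h2, -⟩
    rw [h1, h2 6 (by omega), h6]
    omega
  · rintro j s' hj ⟨h1, h2, h3, h4, h5, h7⟩
    have e2 : s'.idx 2 = s.idx 2 := h3 2 (by omega)
    have e8 : s'.idx 8 = s.idx 8 := h3 8 (by omega)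
    have ej : s.idx 4 + 1 - j - 1 = s.idx 4 - j := by omega
    have ej' : s.idx 4 + 1 - (j + 1) = s.idx 4 - j := by omega
    simp only [halts_seq, halts_instr, eff, cost]
    refine halts_ifNe (fun hn => ?_) (fun he => ?_)
    · simp [h1, e2, e8, ej] at hn
      simp only [halts_instr, eff, cost]
      refine fun u hu => ⟨⟨by simp [h1, ej, ej'], fun _ => ?_, fun x hx => ?_, h4, h5, h7⟩, by omega⟩
      · simp [h1, ej, ej']
        exact ⟨hn, fun c _ _ => by omega⟩
      · simp [show x ≠ 40 by omega, show x ≠ 41 by omega, show x ≠ 42 by omega, h3 x hx]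
    · simp [h1, e2, e8, ej] at he
      refine ⟨⟨by simp [h1, ej, ej'], fun _ => ?_, fun x hx => ?_, h4, h5, h7⟩, by omega⟩
      · have hj1 : 1 ≤ j := by
          rcases Nat.eq_zero_or_pos j with rfl | h
          · exact absurd he hne
          · exact h
        obtain ⟨g1, g2⟩ := h2 hj1
        simp [ej']
        refine ⟨g1, fun c hc hc' => ?_⟩
        rcases eq_or_ne c (s.idx 4 - j) with rfl | hcj
        · exact he
        · exact g2 c (by omega) hc'
      · simp [show x ≠ 99 by omega, show x ≠ 40 by omega, show x ≠ 41 by omega, h3 x hx]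
  · obtain ⟨⟨h1, h2, h3, h4, h5, h7⟩, h8⟩ := h
    obtain ⟨g1, g2⟩ := h2 (by omega)
    exact ⟨⟨g1, fun c hc => g2 c (by omega) hc⟩, h3, h4, h5, h7, by omega⟩

end Programs

/-! ### Lengths of numbers and the cost of multiplication. -/

theorem len_le {q u e : ℕ} (he : 1 ≤ e) (h : u < q ^ e) : len q u ≤ e := by
  have := Nat.log_lt_of_lt_pow' (by omega) h
  unfold len; omega

theorem one_le_len (q u : ℕ) : 1 ≤ len q u := Nat.le_add_left _ _

theorem len_pow {q e : ℕ} (hq : 2 ≤ q) : len q (q ^ e) = e + 1 := by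
  rw [len, Nat.log_pow (by omega)]

/-- The properties of the cost of multiplications. -/
structure IsMulCost (M : ℕ → ℕ) : Prop where
  one_le : 1 ≤ M 1
  div_le : ∀ a b : ℕ, 1 ≤ a → a ≤ b → (M a : ℝ) / a ≤ (M b : ℝ) / b

/-- Through this bound all linear costs are absorbed into `M`. -/
theorem IsMulCost.self_le {M : ℕ → ℕ} (h : IsMulCost M) {a : ℕ} (ha : 1 ≤ a) : a ≤ M a := by
  have h1 := h.div_le 1 a le_rfl ha
  have h2 : (1 : ℝ) ≤ M 1 := by exact_mod_cast h.one_le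
  have h3 : (0 : ℝ) < a := by exact_mod_cast ha
  rw [Nat.cast_one, div_one, le_div_iff₀ h3] at h1
  have : (a : ℝ) ≤ M a := by nlinarith
  exact_mod_cast this

theorem IsMulCost.mul_le_mul {M : ℕ → ℕ} (h : IsMulCost M) {a b : ℕ} (ha : 1 ≤ a) (hab : a ≤ b) :
    M a * b ≤ M b * a := by
  have h1 := h.div_le a b ha hab
  rw [div_le_div_iff₀ (by exact_mod_cast ha) (by exact_mod_cast ha.trans hab)] at h1
  exact_mod_cast h1

theorem IsMulCost.mono {M : ℕ → ℕ} (h : IsMulCost M) {a b : ℕ} (ha : 1 ≤ a) (hab : a ≤ b) :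
    M a ≤ M b :=
  Nat.le_of_mul_le_mul_right ((h.mul_le_mul ha hab).trans (Nat.mul_le_mul_left _ hab))
    (ha.trans hab)

theorem sum_digits_lt {q : ℕ} {d : ℕ → ℕ} (hd : ∀ l, d l < q) (L : ℕ) :
    ∑ l ∈ Finset.range L, d l * q ^ l < q ^ L := by
  induction L with
  | zero => simp
  | succ L ih =>
    rw [Finset.sum_range_succ, pow_succ]
    nlinarith [Nat.mul_le_mul_right (q ^ L) (Nat.succ_le_of_lt (hd L))]

/-! ### Inverses modulo a power of `q`. -/

/-- The number whose base `q` digits below position `L` are `1` at the multiples of `i`. -/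
def onesAt (q i L : ℕ) : ℕ := ∑ l ∈ Finset.range L, (if l % i = 0 then 1 else 0) * q ^ l

theorem onesAt_lt {q : ℕ} (hq : 2 ≤ q) (i L : ℕ) : onesAt q i L < q ^ L :=
  sum_digits_lt (fun l => by split_ifs <;> omega) L

theorem onesAt_pos {q i L : ℕ} (hL : 1 ≤ L) : 1 ≤ onesAt q i L := by
  have := Finset.single_le_sum (f := fun l => (if l % i = 0 then 1 else 0) * q ^ l)
    (fun _ _ => Nat.zero_le _) (Finset.mem_range.2 hL)
  simpa [onesAt] using this

theorem onesAt_add {q i : ℕ} (hi : 1 ≤ i) (L : ℕ) :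
    onesAt q i (i + L) = 1 + q ^ i * onesAt q i L := by
  rw [onesAt, Finset.sum_range_add, onesAt, Finset.mul_sum]
  congr 1
  · rw [Finset.sum_eq_single 0]
    · simp
    · intro l hl hl0
      rw [Nat.mod_eq_of_lt (Finset.mem_range.1 hl), if_neg hl0, zero_mul]
    · intro h; simp at h; omega
  · refine Finset.sum_congr rfl fun l _ => ?_
    rw [Nat.add_mod_left]; ring

/-- This is `(q^i - 1)⁻¹ = -(1 + q^i + q^(2i) + ...)`, truncated. The proof cuts the digit string of
length `L + i` in two ways, after the `L` lowest digits and after the `i` lowest; comparison modulo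
`q ^ L` gives `onesAt q i L * (q ^ i - 1) ≡ -1`. -/
theorem onesAt_modEq {q i L : ℕ} (hq : 2 ≤ q) (hi : 1 ≤ i) :
    (q ^ L - onesAt q i L) * (q ^ i - 1) ≡ 1 [MOD q ^ L] := by
  have h1 := onesAt_add (q := q) hi L
  rw [add_comm i L, onesAt, Finset.sum_range_add, ← onesAt] at h1
  obtain ⟨g, hg⟩ : q ^ L ∣ ∑ x ∈ Finset.range i, (if (L + x) % i = 0 then 1 else 0) * q ^ (L + x) :=
    Finset.dvd_sum fun x _ => Dvd.dvd.mul_left (pow_dvd_pow _ (Nat.le_add_right _ _)) _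
  rw [hg] at h1
  have h2 := onesAt_lt hq i L
  have h3 : 1 ≤ q ^ i := Nat.one_le_pow _ _ (by omega)
  rw [Nat.modEq_iff_dvd]
  push_cast [h2.le, h3]
  zify at h1
  refine ⟨g - (q ^ i - 1), ?_⟩
  linear_combination -h1

section Programs
open Instr Prog

variable {q : ℕ} {M : ℕ → ℕ} {inp : ℕ → ℕ → ℕ}

/-- Index array `3 :=` the digits `1` at the multiples of index register `5`, `0` elsewhere. -/
def onesProg : Prog :=
  zero 50 ;; zero 51 ;; whileLt 50 3 (ifLt 6 51 (store 3 50 6) (store 3 50 7) ;;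
    inc 50 ;; inc 51 ;; ifLt 51 5 (zero 99) (zero 51))

theorem halts_onesProg {s : State} (h6 : s.idx 6 = 0) (h7 : s.idx 7 = 1) (h5 : 1 ≤ s.idx 5) :
    Halts q M inp onesProg s fun s' t =>
      (∀ l < s.idx 3, s'.arr 3 l = if l % s.idx 5 = 0 then 1 else 0) ∧
      (∀ x, x < 50 → s'.idx x = s.idx x) ∧ (∀ a, a ≠ 3 → s'.arr a = s.arr a) ∧
      s'.int = s.int ∧ s'.iarr = s.iarr ∧ t ≤ s.idx 3 * 7 + 3 := by
  rw [onesProg]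
  simp only [halts_seq, halts_instr, eff, cost]
  refine (halts_loop (s.idx 3) (fun j s' => s'.idx 50 = j ∧ s'.idx 51 = j % s.idx 5 ∧
      (∀ l < j, s'.arr 3 l = if l % s.idx 5 = 0 then 1 else 0) ∧
      (∀ x, x < 50 → s'.idx x = s.idx x) ∧ (∀ a, a ≠ 3 → s'.arr a = s.arr a) ∧
      s'.int = s.int ∧ s'.iarr = s.iarr) 6 ?_ ?_ ?_).mono fun s' t h => ?_
  · refine ⟨by simp, by simp, by simp, fun x hx => ?_, by simp, by simp, by simp⟩
    simp [show x ≠ 50 by omega, show x ≠ 51 by omega]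
  · rintro j s' - ⟨h1, -, -, h2, -⟩
    rw [h1, h2 3 (by omega)]
  · rintro j s' hj ⟨h1, h2, h3, h4, ha, hi, hia⟩
    have e5 : s'.idx 5 = s.idx 5 := h4 5 (by omega)
    have e6 : s'.idx 6 = 0 := by rw [h4 6 (by omega), h6]
    have e7 : s'.idx 7 = 1 := by rw [h4 7 (by omega), h7]
    have hmod : (j + 1) % s.idx 5 =
        if j % s.idx 5 + 1 < s.idx 5 then j % s.idx 5 + 1 else 0 := by
      have hlt := Nat.mod_lt j h5
      rw [Nat.add_mod]
      split_ifs with h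
      · rw [Nat.mod_eq_of_lt (a := 1) (by omega), Nat.mod_eq_of_lt h]
      · rcases eq_or_lt_of_le h5 with h1 | h1
        · rw [← h1, Nat.mod_one]
        · rw [Nat.mod_eq_of_lt (a := 1) h1, show j % s.idx 5 + 1 = s.idx 5 by omega, Nat.mod_self]
    simp only [halts_seq, halts_instr, halts_ifLt, eff, cost, e6, h2]
    refine ⟨fun hc => ⟨fun hc' => ?_, fun hc' => ?_⟩, fun hc => ⟨fun hc' => ?_, fun hc' => ?_⟩⟩ <;>
    · simp [h2, e5] at hc'
      refine ⟨⟨by simp [h1], ?_, fun l hl => ?_, fun x hx => ?_, fun a ha' => ?_,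
        by simpa using hi, by simpa using hia⟩, by omega⟩
      · first | rw [hmod, if_pos hc'] | rw [hmod, if_neg hc'.not_gt]
        simp [h2]
      · rcases eq_or_ne l j with rfl | hlj
        · have : (l % s.idx 5 = 0) = ¬ 0 < l % s.idx 5 := by simp
          simp only [this, hc]
          simp [h1, e7]
        · simp [h1, hlj, h3 l (by omega)]
      · simp [show x ≠ 50 by omega, show x ≠ 51 by omega, show x ≠ 99 by omega, h4 x hx]
      · ext c; simp [ha', ha a ha']
  · obtain ⟨⟨h1, h2, h3, h4, h5, h6, h7⟩, h8⟩ := h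
    exact ⟨h3, h4, h5, h6, h7, by omega⟩

/-- Multiply integer register `1` with the inverse of `q ^ i - 1`, modulo `q ^ L`, where `i` is in
index register `5` and `L` in index register `3`. -/
def inverseProg : Prog := onesProg ;; pack 10 3 3 ;; isub 10 2 10 ;; imul 1 1 10 ;; trunc 1 1 3

/-- The arbitrary `d` stands for the denominator collected so far: a single multiplication extends
its inverse by one more factor. -/
theorem halts_inverseProg {s : State} (hq : 2 ≤ q) (hM : IsMulCost M) (h6 : s.idx 6 = 0)
    (h7 : s.idx 7 = 1) (h5 : 1 ≤ s.idx 5) (h3 : 1 ≤ s.idx 3) (h2 : s.int 2 = q ^ s.idx 3)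
    (h1 : s.int 1 < q ^ s.idx 3) :
    Halts q M inp inverseProg s fun s' t =>
      s'.int 1 < q ^ s.idx 3 ∧
      (∀ d, s.int 1 * d ≡ 1 [MOD q ^ s.idx 3] →
        s'.int 1 * (d * (q ^ s.idx 5 - 1)) ≡ 1 [MOD q ^ s.idx 3]) ∧
      (∀ x, x < 50 → s'.idx x = s.idx x) ∧ (∀ a, a ≠ 3 → s'.arr a = s.arr a) ∧
      (∀ w, w ≠ 1 → w ≠ 10 → s'.int w = s.int w) ∧ s'.iarr = s.iarr ∧
      t ≤ M (s.idx 3) + s.idx 3 * 11 + 5 := by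
  rw [inverseProg]
  simp only [halts_seq, halts_instr, eff, cost]
  refine (halts_onesProg h6 h7 h5).mono fun s' t h => ?_
  obtain ⟨g1, g2, g3, g4, g5, g6⟩ := h
  have e3 : s'.idx 3 = s.idx 3 := g2 3 (by omega)
  set L := s.idx 3 with hL
  have hR : ∑ l ∈ Finset.range L, s'.arr 3 l % q * q ^ l = onesAt q (s.idx 5) L := by
    refine Finset.sum_congr rfl fun l hl => ?_
    rw [g1 l (Finset.mem_range.1 hl), Nat.mod_eq_of_lt (by split_ifs <;> omega)]
  simp only [State.setInt_int, State.setInt_idx, State.setInt_arr, State.setInt_iarr, e3, hR, g4, h2,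
    if_true, if_false, Nat.reduceEqDiff, OfNat.one_ne_ofNat]
  have hR1 := onesAt_lt hq (s.idx 5) L
  have hR2 := onesAt_pos (q := q) (i := s.idx 5) h3
  have hqL : 0 < q ^ L := pow_pos (by omega) _
  refine ⟨Nat.mod_lt _ hqL, fun d hd => ?_, g2, g3, fun w hw hw' => by simp [hw, hw'], g5, ?_⟩
  · have h := hd.mul (onesAt_modEq (L := L) hq h5)
    rw [one_mul] at h
    refine Nat.ModEq.trans ?_ h
    rw [show s.int 1 * d * ((q ^ L - onesAt q (s.idx 5) L) * (q ^ s.idx 5 - 1)) =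
      s.int 1 * (q ^ L - onesAt q (s.idx 5) L) * (d * (q ^ s.idx 5 - 1)) by ring]
    exact (Nat.mod_modEq _ _).mul_right _
  · have l1 := len_le (q := q) h3 h1
    have l2 := len_le (q := q) h3 hR1
    have l3 : len q (q ^ L - onesAt q (s.idx 5) L) ≤ L := len_le h3 (by omega)
    have l4 : len q (s.int 1 * (q ^ L - onesAt q (s.idx 5) L)) ≤ 2 * L := by
      refine len_le (by omega) ?_
      rw [two_mul, pow_add]
      exact Nat.mul_lt_mul'' h1 (by omega)
    have l5 := len_pow (e := L) hq
    have l6 : M (max (len q (s.int 1)) (len q (q ^ L - onesAt q (s.idx 5) L))) ≤ M L :=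
      hM.mono (le_max_of_le_left (one_le_len _ _)) (max_le l1 l3)
    have l7 : max (len q (q ^ L)) (len q (onesAt q (s.idx 5) L)) ≤ L + 1 := max_le (by omega) (by omega)
    omega

/-! ### The numerator, by a product tree. -/

/-- Position `i + l` of integer array `0 := q ^ (a - l) - 1` for `l < i`, where `i` is in index
register `5` and `a` in index register `10`. -/
def leavesProg : Prog :=
  copy 60 5 ;; copy 61 10 ;; zero 62 ;; whileLt 62 5 (shl 10 3 61 ;; isub 10 10 3 ;;
    istore 0 60 10 ;; inc 60 ;; dec 61 ;; inc 62)

theorem halts_leavesProg {s : State} (hq : 2 ≤ q) (h3 : s.int 3 = 1) :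
    Halts q M inp leavesProg s fun s' t =>
      s'.idx 60 = 2 * s.idx 5 ∧ (∀ l < s.idx 5, s'.iarr 0 (s.idx 5 + l) = q ^ (s.idx 10 - l) - 1) ∧
      (∀ x, x < 60 → s'.idx x = s.idx x) ∧ s'.arr = s.arr ∧
      (∀ w, w ≠ 10 → s'.int w = s.int w) ∧ t ≤ s.idx 5 * (s.idx 10 * 3 + 7) + 4 := by
  rw [leavesProg]
  simp only [halts_seq, halts_instr, eff, cost]
  refine (halts_loop (s.idx 5) (fun j s' => s'.idx 62 = j ∧ s'.idx 60 = s.idx 5 + j ∧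
      s'.idx 61 = s.idx 10 - j ∧
      (∀ l < j, s'.iarr 0 (s.idx 5 + l) = q ^ (s.idx 10 - l) - 1) ∧
      (∀ x, x < 60 → s'.idx x = s.idx x) ∧ s'.arr = s.arr ∧
      (∀ w, w ≠ 10 → s'.int w = s.int w)) (s.idx 10 * 3 + 6) ?_ ?_ ?_).mono fun s' t h => ?_
  · refine ⟨by simp, by simp, by simp, by simp, fun x hx => ?_, by simp, by simp⟩
    simp [show x ≠ 60 by omega, show x ≠ 61 by omega, show x ≠ 62 by omega]
  · rintro j s' - ⟨h1, -, -, -, h2, -⟩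
    rw [h1, h2 5 (by omega)]
  · rintro j s' hj ⟨h62, h60, h61, hl, hi, ha, hn⟩
    have e3 : s'.int 3 = 1 := by rw [hn 3 (by omega), h3]
    have hp : 1 ≤ q ^ (s.idx 10 - j) := Nat.one_le_pow _ _ (by omega)
    simp only [halts_seq, halts_instr, eff, cost]
    refine ⟨⟨by simp [h62], by simp [h60, add_assoc], by simp [h61]; omega, fun l hl' => ?_,
      fun x hx => ?_, by simpa using ha, fun w hw => by simp [hw, hn w hw]⟩, ?_⟩
    · rcases eq_or_ne l j with rfl | hlj
      · simp [h60, h61, e3]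
      · simp [h60, hlj, hl l (by omega)]
    · simp [show x ≠ 60 by omega, show x ≠ 61 by omega, show x ≠ 62 by omega, hi x hx]
    · simp [e3, h61]
      have l1 : len q 1 = 1 := by simp [len]
      have l2 := len_pow (e := s.idx 10 - j) hq
      have l3 : len q (q ^ (s.idx 10 - j) - 1) ≤ s.idx 10 - j + 1 :=
        len_le (by omega) (by rw [pow_succ]; nlinarith [Nat.sub_lt hp one_pos])
      rw [l1, l2]
      omega
  · obtain ⟨⟨h1, h2, h3, h4, h5, h6, h7⟩, h8⟩ := h
    exact ⟨by omega, h4, h5, h6, h7, by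
      change t ≤ s.idx 5 * (s.idx 10 * 3 + 7) + 1 at h8
      omega⟩

/-- Position `1` of integer array `0 :=` the product of the numbers at the positions `i`, ...,
`2 * i - 1`, where `i` is in index register `5`. -/
def heapProg : Prog :=
  copy 63 5 ;; whileLt 7 63 (dec 63 ;; dec 60 ;; iload 11 0 60 ;; dec 60 ;; iload 12 0 60 ;;
    imul 11 11 12 ;; istore 0 63 11)

/-- If every node `y` below `x` has at most `A / y` digits, then so has `x`, being the product of
the nodes `2 * x` and `2 * x + 1`. This bounds all sizes without regard to levels, and the number of
leaves need not be a power of two. -/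
theorem div_add_div_le (A : ℕ) {x : ℕ} (hx : 1 ≤ x) : A / (2 * x) + A / (2 * x + 1) ≤ A / x := by
  have h1 : A / (2 * x + 1) ≤ A / (2 * x) := Nat.div_le_div_left (by omega) (by omega)
  have h2 : A / (2 * x) * 2 ≤ A / x := by
    rw [Nat.le_div_iff_mul_le hx, mul_assoc]
    exact Nat.div_mul_le_self _ _
  omega

/-- The window from `x` to `2 * x - 1` is a frontier of the tree: moving it down by one position
trades two children for their parent, so its product is invariant. -/
theorem prod_Ico_heap {h : ℕ → ℕ} {x v : ℕ} (hx : 1 ≤ x) (hv : v = h (2 * x + 1) * h (2 * x)) :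
    ∏ y ∈ Finset.Ico x (2 * x), Function.update h x v y =
      ∏ y ∈ Finset.Ico (x + 1) (2 * (x + 1)), h y := by
  rw [Finset.prod_eq_prod_Ico_succ_bot (by omega), Function.update_self,
    show 2 * (x + 1) = 2 * x + 1 + 1 by ring, Finset.prod_Ico_succ_top (by omega),
    Finset.prod_Ico_succ_top (by omega), hv]
  rw [Finset.prod_congr rfl fun y hy => Function.update_of_ne
    (show y ≠ x by have := Finset.mem_Ico.1 hy; omega) _ _]
  ring

theorem halts_heapProg {s : State} {n i : ℕ} (hq : 2 ≤ q) (hM : IsMulCost M) (hn : 1 ≤ n)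
    (hi : 1 ≤ i) (h5 : s.idx 5 = i) (h7 : s.idx 7 = 1) (h60 : s.idx 60 = 2 * i)
    (hb : ∀ l < i, s.iarr 0 (i + l) < q ^ n) :
    Halts q M inp heapProg s fun s' t =>
      s'.iarr 0 1 = ∏ l ∈ Finset.range i, s.iarr 0 (i + l) ∧
      (∀ x, x < 60 → s'.idx x = s.idx x) ∧ s'.arr = s.arr ∧
      (∀ w, w < 11 → s'.int w = s.int w) ∧
      t ≤ 9 * ∑ x ∈ Finset.range (i - 1), M (n * i / (x + 1)) + 2 := by
  rw [heapProg]
  simp only [halts_seq, halts_instr, eff, cost]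
  refine (halts_loop_sum (i - 1) (fun j s' => s'.idx 63 = i - j ∧ s'.idx 60 = 2 * (i - j) ∧
      ∏ y ∈ Finset.Ico (i - j) (2 * (i - j)), s'.iarr 0 y =
        ∏ l ∈ Finset.range i, s.iarr 0 (i + l) ∧
      (∀ y, i - j ≤ y → y < 2 * i → s'.iarr 0 y < q ^ (n * (2 * i - 1) / y)) ∧
      (∀ x, x < 60 → s'.idx x = s.idx x) ∧ s'.arr = s.arr ∧
      (∀ w, w < 11 → s'.int w = s.int w)) (fun j => 8 * M (n * i / (i - 1 - j))) ?_ ?_ ?_).mono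
        fun s' t h => ?_
  · refine ⟨by simp [h5], by simp [h60], ?_, fun y hy hy' => ?_, fun x hx => ?_, by simp, by simp⟩
    · rw [Finset.prod_Ico_eq_prod_range]
      simp [two_mul]
    -- The numerator `n * (2 * i - 1)` allows `n` digits even to the last leaf, at position `2 * i -
    -- 1`.
    · obtain ⟨l, rfl⟩ := Nat.exists_eq_add_of_le hy
      refine (hb l (by omega)).trans_le (Nat.pow_le_pow_right (by omega) ?_)
      rw [Nat.le_div_iff_mul_le (by omega)]
      exact Nat.mul_le_mul_left _ (by omega)
    · simp [show x ≠ 63 by omega]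
  · rintro j s' hj ⟨h1, -, -, -, h2, -⟩
    rw [h1, h2 7 (by omega), h7]
    omega
  · rintro j s' hj ⟨g63, g60, gp, gb, gi, ga, gn⟩
    obtain ⟨x, hx⟩ : ∃ x, i - 1 - j = x := ⟨_, rfl⟩
    have hx1 : 1 ≤ x := by omega
    have hxi : i - j = x + 1 := by omega
    have hxi' : i - (j + 1) = x := by omega
    have e63 : i - j - 1 = x := by omega
    have e60 : 2 * (i - j) - 1 = 2 * x + 1 := by omega
    have hw1 : 1 ≤ n * i / x := by
      rw [Nat.le_div_iff_mul_le hx1, one_mul]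
      exact (show x ≤ i by omega).trans (Nat.le_mul_of_pos_left _ hn)
    have hA : n * (2 * i - 1) / (2 * x) ≤ n * i / x := by
      rw [← Nat.mul_div_mul_left (n * i) x two_pos]
      refine Nat.div_le_div_right ?_
      rw [Nat.mul_left_comm]
      exact Nat.mul_le_mul_left _ (by omega)
    have hA' : n * (2 * i - 1) / (2 * x + 1) ≤ n * i / x :=
      (Nat.div_le_div_left (by omega) (by omega)).trans hA
    have b1 := gb (2 * x) (by omega) (by omega)
    have b2 := gb (2 * x + 1) (by omega) (by omega)
    have c1 := b1.trans_le (Nat.pow_le_pow_right (by omega) hA)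
    have c2 := b2.trans_le (Nat.pow_le_pow_right (by omega) hA')
    simp only [halts_seq, halts_instr, eff, cost]
    refine ⟨⟨by simp [g63]; omega, by simp [g60]; omega, ?_, fun y hy hy' => ?_,
      fun x hx => ?_, by simpa using ga, fun w hw => ?_⟩, ?_⟩
    · rw [← gp, hxi, hxi', ← prod_Ico_heap hx1 rfl]
      refine Finset.prod_congr rfl fun y hy => ?_
      simp [g63, g60, e63, e60, Function.update_apply]
    · rw [hxi'] at hy
      rcases eq_or_ne y x with rfl | hyx
      · simp [g63, g60, e63, e60]
        refine lt_of_lt_of_le (Nat.mul_lt_mul'' b2 b1) ?_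
        rw [← pow_add, add_comm]
        exact Nat.pow_le_pow_right (by omega) (div_add_div_le _ hx1)
      · simp [g63, e63, hyx]
        exact gb y (by omega) hy'
    · simp [show x ≠ 60 by omega, show x ≠ 63 by omega, gi x hx]
    · simp [show w ≠ 11 by omega, show w ≠ 12 by omega, gn w hw]
    · simp [g60, e60, hx]
      have l1 := len_le hw1 c1
      have l2 := len_le hw1 c2
      have l3 : len q (s'.iarr 0 (2 * x + 1) * s'.iarr 0 (2 * x)) ≤ 2 * (n * i / x) := by
        refine len_le (by omega) ?_
        rw [two_mul (n * i / x), pow_add]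
        exact Nat.mul_lt_mul'' c2 c1
      have l4 : M (max (len q (s'.iarr 0 (2 * x + 1))) (len q (s'.iarr 0 (2 * x)))) ≤
          M (n * i / x) := hM.mono (le_max_of_le_left (one_le_len _ _)) (max_le l2 l1)
      have l5 := hM.self_le hw1
      omega
  · obtain ⟨⟨h1, h2, h3, h4, h5, h6, h7⟩, h8⟩ := h
    have hi1 : i - (i - 1) = 1 := by omega
    rw [hi1] at h3
    refine ⟨by rw [← h3]; simp, h5, h6, h7, ?_⟩
    have : ∑ j ∈ Finset.range (i - 1), (8 * M (n * i / (i - 1 - j)) + 1) ≤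
        9 * ∑ x ∈ Finset.range (i - 1), M (n * i / (x + 1)) := by
      rw [← Finset.sum_range_reflect, Finset.mul_sum]
      refine Finset.sum_le_sum fun j hj => ?_
      have hj' := Finset.mem_range.1 hj
      rw [show i - 1 - (i - 1 - 1 - j) = j + 1 by omega]
      have : 1 ≤ n * i / (j + 1) := by
        rw [Nat.le_div_iff_mul_le (by omega), one_mul]
        exact (show j + 1 ≤ i by omega).trans (Nat.le_mul_of_pos_left _ hn)
      have := hM.self_le this
      omega
    omega

/-- Integer register `11 :=` the product of `q ^ (a - l) - 1` for `l < i` and integer register `1`,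
modulo `q ^ L`. -/
def productProg : Prog :=
  leavesProg ;; heapProg ;; iload 11 0 7 ;; imul 11 11 1 ;; trunc 11 11 3

theorem halts_productProg {s : State} {n k i a : ℕ} (hq : 2 ≤ q) (hM : IsMulCost M)
    (hi : 1 ≤ i) (hik : i ≤ k) (ha : a ≤ n) (hn : 1 ≤ n) (h3 : s.idx 3 = n * k)
    (h5 : s.idx 5 = i) (h10 : s.idx 10 = a) (h7 : s.idx 7 = 1)
    (i3 : s.int 3 = 1) (i1 : s.int 1 < q ^ (n * k)) :
    Halts q M inp productProg s fun s' t =>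
      s'.int 11 = (∏ l ∈ Finset.range i, (q ^ (a - l) - 1)) * s.int 1 % q ^ (n * k) ∧
      (∀ x, x < 60 → s'.idx x = s.idx x) ∧ s'.arr = s.arr ∧
      (∀ w, w < 10 → s'.int w = s.int w) ∧
      t ≤ 9 * ∑ x ∈ Finset.range (k - 1), M (n * k / (x + 1)) + M (n * k) + n * k * 13 + 6 := by
  rw [productProg]
  simp only [halts_seq, halts_instr, eff, cost]
  have hL : 1 ≤ n * k := Nat.mul_pos hn (hi.trans hik)
  refine (halts_leavesProg hq i3).mono fun s1 t1 h => ?_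
  rw [h5, h10] at h
  obtain ⟨a1, a2, a3, a4, a5, a6⟩ := h
  have hlt : ∀ l < i, s1.iarr 0 (i + l) < q ^ n := by
    intro l hl
    rw [a2 l hl]
    exact (Nat.sub_lt (pow_pos (by omega) _) one_pos).trans_le
      (Nat.pow_le_pow_right (by omega) (by omega))
  refine (halts_heapProg hq hM hn hi (by rw [a3 5 (by omega), h5]) (by rw [a3 7 (by omega), h7])
    a1 hlt).mono fun s2 t2 h => ?_
  obtain ⟨b1, b2, b3, b4, b5⟩ := h
  rw [Finset.prod_congr rfl fun l hl => a2 l (Finset.mem_range.1 hl)] at b1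
  have e7 : s2.idx 7 = 1 := by rw [b2 7 (by omega), a3 7 (by omega), h7]
  have e3 : s2.idx 3 = n * k := by rw [b2 3 (by omega), a3 3 (by omega), h3]
  have e1 : s2.int 1 = s.int 1 := by rw [b4 1 (by omega), a5 1 (by omega)]
  set P := ∏ l ∈ Finset.range i, (q ^ (a - l) - 1) with hP
  have hPlt : P < q ^ (n * k) := (prod_pow_sub_lt hq a hi).trans_le
    (Nat.pow_le_pow_right (by omega) (Nat.mul_le_mul ha hik))
  refine ⟨by simp [e7, e3, e1, b1], fun x hx => ?_, ?_, fun w hw => ?_, ?_⟩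
  · simp [b2 x hx, a3 x hx]
  · simp [b3, a4]
  · simp [show w ≠ 11 by omega, b4 w (by omega), a5 w (by omega)]
  · simp [e7, b1, e1]
    have l1 := len_le hL hPlt
    have l2 := len_le hL i1
    have l3 : len q (P * s.int 1) ≤ 2 * (n * k) := by
      refine len_le (by omega) ?_
      rw [two_mul, pow_add]
      exact Nat.mul_lt_mul'' hPlt i1
    have l4 : M (max (len q P) (len q (s.int 1))) ≤ M (n * k) :=
      hM.mono (le_max_of_le_left (one_le_len _ _)) (max_le l1 l2)
    have l5 : ∑ x ∈ Finset.range (i - 1), M (n * i / (x + 1)) ≤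
        ∑ x ∈ Finset.range (k - 1), M (n * k / (x + 1)) := by
      refine (Finset.sum_le_sum fun x hx => ?_).trans (Finset.sum_le_sum_of_subset
        (Finset.range_subset_range.2 (by omega)))
      have hx' := Finset.mem_range.1 hx
      refine hM.mono ?_ (Nat.div_le_div_right (Nat.mul_le_mul_left _ hik))
      rw [Nat.le_div_iff_mul_le (by omega), one_mul]
      exact (show x + 1 ≤ i by omega).trans (Nat.le_mul_of_pos_left _ hn)
    have l6 : i * (a * 3 + 7) ≤ n * k * 10 := by
      have : i * a ≤ n * k := by rw [mul_comm n k]; exact Nat.mul_le_mul hik ha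
      have : i ≤ n * k := hik.trans (Nat.le_mul_of_pos_left _ hn)
      rw [mul_add, ← mul_assoc]
      omega
    omega

end Programs

/-- Exact division without dividing: modulo `q ^ L` the product is congruent to the quotient, which
is itself below `q ^ L`. -/
theorem prod_mul_mod_eq_gauss {q a i v L : ℕ} (hq : 2 ≤ q) (hi : 1 ≤ i) (hL : a * i ≤ L)
    (hv : v * ∏ l ∈ Finset.range i, (q ^ (l + 1) - 1) ≡ 1 [MOD q ^ L]) :
    (∏ l ∈ Finset.range i, (q ^ (a - l) - 1)) * v % q ^ L = gauss q a i := by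
  have h := (hv.mul_left (gauss q a i))
  rw [mul_one, ← mul_assoc, mul_right_comm, gauss_mul_prod hq] at h
  rw [h, Nat.mod_eq_of_lt]
  exact (gauss_lt hq a hi).trans_le (Nat.pow_le_pow_right (by omega) hL)

/-- By Pascal's rule `q ^ (m - i) * gauss q m i` is at most `gauss q (m + 1) (i + 1)`, whose indices
do not exceed `n` and `k`. -/
theorem mul_add_lt_pow {q n k m i D j : ℕ} (hq : 2 ≤ q) (hi : i ≤ m) (hm : m < n) (hk : i < k)
    (hD : D < gauss q m i) (hj : j < q ^ (m - i)) : q ^ (m - i) * D + j < q ^ (n * k) := by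
  have h1 : q ^ (m - i) * D + j < q ^ (m - i) * gauss q m i := by nlinarith
  have h2 := gauss_pascal hq hi
  have h3 := gauss_lt hq (m + 1) (show 1 ≤ i + 1 by omega)
  have h4 : q ^ ((m + 1) * (i + 1)) ≤ q ^ (n * k) :=
    Nat.pow_le_pow_right (by omega) (Nat.mul_le_mul hm hk)
  omega

section Programs
open Instr Prog

variable {q : ℕ} {M : ℕ → ℕ} {inp : ℕ → ℕ → ℕ}

/-! ### The main loop over the columns. -/

/-- The contents of those registers that do not change in the main loop. -/
structure IsReady (q : ℕ) (inp : ℕ → ℕ → ℕ) (n k z : ℕ) (s : State) : Prop where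
  idx_zero : s.idx 0 = n
  idx_one : s.idx 1 = k
  idx_two : s.idx 2 = z
  idx_three : s.idx 3 = n * k
  idx_six : s.idx 6 = 0
  idx_seven : s.idx 7 = 1
  int_two : s.int 2 = q ^ (n * k)
  int_three : s.int 3 = 1
  int_four : s.int 4 = 0
  table : IsEndTable inp n z k (s.arr 0)

/-- The invariant of the main loop, when `m` columns have been processed. -/
structure LoopInv (q : ℕ) (inp : ℕ → ℕ → ℕ) (n k z m i : ℕ) (L : Finset ℕ) (D : ℕ) (s : State) :
    Prop extends IsReady q inp n k z s where
  idx_four : s.idx 4 = m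
  idx_five : s.idx 5 = i
  marks : Marks L s
  int_zero : s.int 0 = D
  int_one_lt : s.int 1 < q ^ (n * k)
  int_one_mul : s.int 1 * ∏ l ∈ Finset.range i, (q ^ (l + 1) - 1) ≡ 1 [MOD q ^ (n * k)]

/-- Integer register `5 := q ^ (m - i) * D + j`, where `j` is the number given by the row that ends in
column `m`. -/
def shiftProg : Prog :=
  dec 20 ;; copy 8 20 ;; inc 5 ;; digitsProg ;; pack 10 2 30 ;; shl 0 0 30 ;; iadd 5 0 10

theorem halts_shiftProg {s : State} {n k z m i r D : ℕ} {L : Finset ℕ} (hq : 2 ≤ q)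
    (hs : LoopInv q inp n k z m i L D s) (h20 : s.idx 20 = r + 1) (hm : m < n) (hik : i < k)
    (hi : i ≤ m) (hL : posBelow L m = m - i) (hD : D < gauss q m i) (hd : ∀ c, inp r c < q) :
    Halts q M inp shiftProg s fun s' t =>
      s'.int 5 = q ^ (m - i) * D + packOutside q L (inp r) m ∧ s'.idx 8 = r ∧ s'.idx 5 = i + 1 ∧
      (∀ x, x < 8 → x ≠ 5 → s'.idx x = s.idx x) ∧ (∀ a, a ≠ 2 → s'.arr a = s.arr a) ∧
      (∀ w, w ≠ 0 → w < 5 → s'.int w = s.int w) ∧ t ≤ n * k * 11 + 7 := by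
  have hj := packOutside_lt (L := L) hd m
  rw [hL] at hj
  have hX := mul_add_lt_pow hq hi hm hik hD hj
  have hL1 : 1 ≤ n * k := Nat.mul_pos (by omega) (by omega)
  have hnk : n ≤ n * k := Nat.le_mul_of_pos_right _ (by omega)
  have hqp : 1 ≤ q ^ (m - i) := Nat.one_le_pow _ _ (by omega)
  have hDX : D ≤ q ^ (m - i) * D := Nat.le_mul_of_pos_left _ hqp
  rw [shiftProg]
  simp only [halts_seq, halts_instr, eff, cost]
  refine (halts_digitsProg (L := L) (by simpa using hs.idx_six) (fun c => by simpa using hs.marks c)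
    (by simpa [h20] using hd)).mono fun s1 t1 h => ?_
  simp [h20, hs.idx_four, hL] at h
  obtain ⟨g1, g2, g3, g4, g5, g6, g7⟩ := h
  have e0 : s1.int 0 = D := by rw [g5]; exact hs.int_zero
  have e8 : s1.idx 8 = r := by rw [g3 8 (by omega)]; simp
  have e5 : s1.idx 5 = i + 1 := by rw [g3 5 (by omega)]; simp [hs.idx_five]
  refine ⟨by simp [g1, g2, e0]; ring, by simp [e8], by simp [e5], fun x hx hx' => ?_,
    fun a ha => by simp [g4 a ha], fun w hw hw' => ?_, ?_⟩
  · simp [g3 x (by omega), show x ≠ 20 by omega, show x ≠ 8 by omega, hx']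
  · simp [g5, hw, show w ≠ 5 by omega, show w ≠ 10 by omega]
  · simp [g1, g2, e0]
    rw [mul_comm D]
    have l1 : len q D ≤ n * k := len_le hL1 (by omega)
    have l2 : len q (q ^ (m - i) * D) ≤ n * k := len_le hL1 (by omega)
    have l3 : len q (packOutside q L (inp r) m) ≤ n * k := len_le hL1 (by omega)
    omega

/-- Index register `10 :=` the column `m` in register `4`, or `m + 1` if integer register `5` is zero. -/
def topProg : Prog := copy 10 4 ;; ile 22 5 4 ;; ifLt 6 22 (inc 10) (zero 99)

theorem halts_topProg {s : State} (h6 : s.idx 6 = 0) (h4 : s.int 4 = 0) :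
    Halts q M inp topProg s fun s' t =>
      s'.idx 10 = (if s.int 5 = 0 then s.idx 4 + 1 else s.idx 4) ∧
      (∀ x, x < 10 → s'.idx x = s.idx x) ∧ s'.arr = s.arr ∧ s'.int = s.int ∧
      t ≤ len q (s.int 5) + 3 := by
  have hl : len q 0 ≤ len q (s.int 5) := by simp [len]
  rw [topProg]
  simp only [halts_seq, halts_instr, halts_ifLt, eff, cost]
  refine ⟨fun h => ?_, fun h => ?_⟩
  · simp [h6, h4] at h
    have h : s.int 5 = 0 := by by_contra hne; simp [hne] at h
    refine ⟨by simp [h], fun x hx => ?_, rfl, rfl, ?_⟩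
    · simp [show x ≠ 10 by omega, show x ≠ 22 by omega]
    · simp [h4, max_eq_left hl]; omega
  · simp [h6, h4] at h
    refine ⟨by simp [h], fun x hx => ?_, rfl, rfl, ?_⟩
    · simp [show x ≠ 10 by omega, show x ≠ 22 by omega, show x ≠ 99 by omega]
    · simp [h4, max_eq_left hl]; omega

/-- Process the row whose number plus one is in index register `20`. -/
def rowProg : Prog :=
  shiftProg ;; leadProg ;; store 1 42 7 ;; inverseProg ;; topProg ;; productProg ;;
    iadd 11 11 5 ;; isub 0 11 3

/-- The order matters: the digits are read before the leading column of this row is marked, since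
`L` must belong to the earlier rows; and register `5` is raised before the inverse is updated, so
that the factor `q ^ (i + 1) - 1` enters. The cost is one product tree and two multiplications at
full precision. -/
theorem halts_rowProg {s : State} {n k z m i r l D : ℕ} {L : Finset ℕ} (hq : 2 ≤ q)
    (hM : IsMulCost M) (hs : LoopInv q inp n k z m i L D s) (h20 : s.idx 20 = r + 1) (hm : m < n)
    (hik : i < k) (hi : i ≤ m) (hL : posBelow L m = m - i) (hD : D < gauss q m i)
    (hd : ∀ c, inp r c < q) (hr : inp r m ≠ z) (hl : LeadsAt inp z r l) :
    Halts q M inp rowProg s fun s' t =>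
      LoopInv q inp n k z m (i + 1) (insert l L)
        (decodeStep q m i D (packOutside q L (inp r) m)) s' ∧
      t ≤ 9 * ∑ x ∈ Finset.range (k - 1), M (n * k / (x + 1)) + 2 * M (n * k) + n * k * 44 + 40 := by
  have hj := packOutside_lt (L := L) hd m
  rw [hL] at hj
  have hX := mul_add_lt_pow hq hi hm hik hD hj
  have hL1 : 1 ≤ n * k := Nat.mul_pos (by omega) (by omega)
  have hnk : n ≤ n * k := Nat.le_mul_of_pos_right _ (by omega)
  rw [rowProg]
  simp only [halts_seq, halts_instr, eff, cost]
  refine (halts_shiftProg hq hs h20 hm hik hi hL hD hd).mono fun s1 t1 h => ?_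
  obtain ⟨a1, a2, a3, a4, a5, a6, a7⟩ := h
  have a44 : s1.idx 4 = m := by rw [a4 4 (by omega) (by omega), hs.idx_four]
  have a42 : s1.idx 2 = z := by rw [a4 2 (by omega) (by omega), hs.idx_two]
  have a47 : s1.idx 7 = 1 := by rw [a4 7 (by omega) (by omega), hs.idx_seven]
  have a46 : s1.idx 6 = 0 := by rw [a4 6 (by omega) (by omega), hs.idx_six]
  have a43 : s1.idx 3 = n * k := by rw [a4 3 (by omega) (by omega), hs.idx_three]
  refine (halts_leadProg a46 (by rw [a2, a44, a42]; exact hr)).mono fun s2 t2 h => ?_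
  rw [a42, a2, a44] at h
  obtain ⟨b1, b2, b3, b4, -, b6⟩ := h
  have b1' := b1.unique hl
  refine (halts_inverseProg hq hM (by simp [b2, a46]) (by simp [b2, a47]) (by simp [b2, a3])
    (by simpa [b2, a43] using hL1)
    (by simp [b2, a43, b4, a6, hs.int_two])
    (by simpa [b2, a43, b4, a6] using hs.int_one_lt)).mono fun s3 t3 h => ?_
  simp [b2, b4, a43, a3, a6] at h
  obtain ⟨c1, c2, c3, c4, c5, -, c7⟩ := h
  have c2' := c2 _ hs.int_one_mul
  rw [← Finset.prod_range_succ (fun l => q ^ (l + 1) - 1)] at c2'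
  have c3' : ∀ x, x < 40 → s3.idx x = s1.idx x := fun x hx => by rw [c3 x (by omega), b2 x hx]
  have c55 : s3.int 5 = q ^ (m - i) * D + packOutside q L (inp r) m := by
    rw [c5 5 (by omega) (by omega), a1]
  refine (halts_topProg (by rw [c3' 6 (by omega), a46])
    (by rw [c5 4 (by omega) (by omega), a6 4 (by omega) (by omega), hs.int_four])).mono
      fun s4 t4 h => ?_
  rw [c55, c3' 4 (by omega), a44] at h
  obtain ⟨d1, d2, d3, d4, d5⟩ := h
  have d2' : ∀ x, x < 10 → s4.idx x = s1.idx x := fun x hx => by rw [d2 x hx, c3' x (by omega)]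
  set X := q ^ (m - i) * D + packOutside q L (inp r) m with hXdef
  set a := if X = 0 then m + 1 else m with ha
  have han : a ≤ n := by rw [ha]; split_ifs <;> omega
  refine (halts_productProg (n := n) (k := k) (i := i + 1) (a := a) hq hM (by omega) hik han
    (by omega) (by rw [d2' 3 (by omega), a43]) (by rw [d2' 5 (by omega), a3]) d1
    (by rw [d2' 7 (by omega), a47])
    (by rw [d4, c5 3 (by omega) (by omega), a6 3 (by omega) (by omega), hs.int_three])
    (by rw [d4]; exact c1)).mono fun s5 t5 h => ?_
  obtain ⟨e1, e2, e3, e4, e5⟩ := h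
  have haL : a * (i + 1) ≤ n * k := Nat.mul_le_mul han hik
  rw [d4, prod_mul_mod_eq_gauss hq (by omega) haL c2'] at e1
  have e2' : ∀ x, x < 8 → x ≠ 5 → s5.idx x = s.idx x := fun x hx hx' => by
    rw [e2 x (by omega), d2' x (by omega), a4 x hx hx']
  have e4' : ∀ w, w ≠ 0 → w ≠ 1 → w < 5 → s5.int w = s.int w := fun w h0 h1 hw => by
    rw [e4 w (by omega), d4, c5 w h1 (by omega), a6 w h0 hw]
  have e55 : s5.int 5 = X := by rw [e4 5 (by omega), d4, c55]
  have hG : gauss q a (i + 1) < q ^ (n * k) :=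
    (gauss_lt hq a (by omega)).trans_le (Nat.pow_le_pow_right (by omega) haL)
  have harr : ∀ b c, b ≠ 3 → b ≠ 2 → s5.arr b c = if b = 1 ∧ c = l then 1 else s.arr b c := by
    intro b c hb hb'
    rw [e3, d3, c4 b hb, State.setArr_arr, b1', b3, a5 b hb', a47]
  refine ⟨{ idx_zero := ?_, idx_one := ?_, idx_two := ?_, idx_three := ?_, idx_six := ?_,
            idx_seven := ?_, int_two := ?_, int_three := ?_, int_four := ?_, table := ?_,
            idx_four := ?_, idx_five := ?_, marks := ?_, int_zero := ?_, int_one_lt := ?_,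
            int_one_mul := ?_ }, ?_⟩
  · simp [e2', hs.idx_zero]
  · simp [e2', hs.idx_one]
  · simp [e2', hs.idx_two]
  · simp [e2', hs.idx_three]
  · simp [e2', hs.idx_six]
  · simp [e2', hs.idx_seven]
  · simp [e4', hs.int_two]
  · simp [e4', hs.int_three]
  · simp [e4', hs.int_four]
  · intro c hc
    have := hs.table c hc
    simpa [harr 0 c (by omega) (by omega)] using this
  · simp [e2', hs.idx_four]
  · simp [e2, d2', a3]
  · intro c
    have := hs.marks c
    simp [harr 1 c (by omega) (by omega), this]
    split_ifs <;> simp_all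
  · simp [e1, e55, e4', hs.int_three]
    rfl
  · simp [e4 1, d4, c1]
  · simpa [e4 1, d4] using c2'
  · simp [e1, e55, e4', hs.int_three]
    have l0 : len q 1 = 1 := by simp [len]
    have l1 := len_le hL1 hG
    have l2 := len_le hL1 hX
    have l3 : len q (gauss q a (i + 1) + X) ≤ n * k + 1 := len_le (by omega) (by
      rw [pow_succ]
      have := Nat.mul_le_mul_left (q ^ (n * k)) hq
      omega)
    omega

theorem LoopInv.setIdx {n k z m i D : ℕ} {L : Finset ℕ} {s : State}
    (h : LoopInv q inp n k z m i L D s) {x : ℕ} (hx : 8 ≤ x) (v : ℕ) :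
    LoopInv q inp n k z m i L D (s.setIdx x v) where
  idx_zero := by simp [h.idx_zero, show ¬ 0 = x by omega]
  idx_one := by simp [h.idx_one, show ¬ 1 = x by omega]
  idx_two := by simp [h.idx_two, show ¬ 2 = x by omega]
  idx_three := by simp [h.idx_three, show ¬ 3 = x by omega]
  idx_six := by simp [h.idx_six, show ¬ 6 = x by omega]
  idx_seven := by simp [h.idx_seven, show ¬ 7 = x by omega]
  int_two := h.int_two
  int_three := h.int_three
  int_four := h.int_four
  table := h.table
  idx_four := by simp [h.idx_four, show ¬ 4 = x by omega]
  idx_five := by simp [h.idx_five, show ¬ 5 = x by omega]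
  marks := h.marks
  int_zero := h.int_zero
  int_one_lt := h.int_one_lt
  int_one_mul := h.int_one_mul

theorem LoopInv.next {n k z m i D : ℕ} {L : Finset ℕ} {s : State}
    (h : LoopInv q inp n k z m i L D s) :
    LoopInv q inp n k z (m + 1) i L D (s.setIdx 4 (s.idx 4 + 1)) where
  idx_zero := by simp [h.idx_zero]
  idx_one := by simp [h.idx_one]
  idx_two := by simp [h.idx_two]
  idx_three := by simp [h.idx_three]
  idx_six := by simp [h.idx_six]
  idx_seven := by simp [h.idx_seven]
  int_two := h.int_two
  int_three := h.int_three
  int_four := h.int_four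
  table := h.table
  idx_four := by simp [h.idx_four]
  idx_five := by simp [h.idx_five]
  marks := h.marks
  int_zero := h.int_zero
  int_one_lt := h.int_one_lt
  int_one_mul := h.int_one_mul

/-- An upper bound for the number of operations of `rowProg`. -/
def rowCost (M : ℕ → ℕ) (n k : ℕ) : ℕ :=
  9 * ∑ x ∈ Finset.range (k - 1), M (n * k / (x + 1)) + 2 * M (n * k) + n * k * 44 + 40

/-- Process the column in index register `4`. -/
def columnProg : Prog := load 20 0 4 ;; ifLt 6 20 rowProg (zero 99) ;; inc 4

theorem halts_columnProg_of_not_endsAt {s : State} {n k z m i D : ℕ} {L : Finset ℕ}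
    (hs : LoopInv q inp n k z m i L D s) (hm : m < n) (hr : ∀ r < k, ¬ EndsAt inp n z r m) :
    Halts q M inp columnProg s fun s' t => LoopInv q inp n k z (m + 1) i L D s' ∧ t ≤ 4 := by
  have hT : s.arr 0 m = 0 := by
    rcases hs.table m hm with ⟨h, -⟩ | ⟨r, hrk, -, hE⟩
    · exact h
    · exact absurd hE (hr r hrk)
  rw [columnProg]
  simp only [halts_seq, halts_instr, halts_ifLt, eff, cost]
  refine ⟨fun h => ?_, fun _ => ⟨((hs.setIdx (by omega) _).setIdx (by omega) _).next, by omega⟩⟩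
  simp [hs.idx_four, hT] at h

theorem halts_columnProg_of_endsAt {s : State} {n k z m i r l D : ℕ} {L : Finset ℕ} (hq : 2 ≤ q)
    (hM : IsMulCost M) (hs : LoopInv q inp n k z m i L D s) (hm : m < n) (hik : i < k)
    (hi : i ≤ m) (hL : posBelow L m = m - i) (hD : D < gauss q m i)
    (hd : ∀ c, inp r c < q) (hrk : r < k) (hr : EndsAt inp n z r m)
    (huniq : ∀ r' < k, EndsAt inp n z r' m → r' = r) (hl : LeadsAt inp z r l) :
    Halts q M inp columnProg s fun s' t =>
      LoopInv q inp n k z (m + 1) (i + 1) (insert l L)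
        (decodeStep q m i D (packOutside q L (inp r) m)) s' ∧ t ≤ rowCost M n k + 3 := by
  have hT : s.arr 0 m = r + 1 := by
    rcases hs.table m hm with ⟨-, h⟩ | ⟨r', hrk', h, hE⟩
    · exact absurd hr (h r hrk)
    · rw [h, huniq r' hrk' hE]
  rw [columnProg]
  simp only [halts_seq, halts_instr, halts_ifLt, eff, cost]
  refine ⟨fun _ => ?_, fun h => absurd h (by simp [hs.idx_four, hs.idx_six, hT])⟩
  refine (halts_rowProg hq hM (hs.setIdx (by omega) _) (by simp [hs.idx_four, hT]) hm hik hi hL hD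
    hd hr.1 hl).mono fun s1 t1 h => ⟨h.1.next, ?_⟩
  have := h.2
  rw [rowCost]
  omega

/-- Process all columns. -/
def mainLoop : Prog := whileLt 4 0 columnProg

/-- A trace grows at its end whereas a loop unfolds at its beginning. Stating the claim with a
continuation `Q`, generalized in the induction, reconciles the two. -/
theorem halts_mainLoop_of_trace {n k z m i D : ℕ} {L : Finset ℕ} (hq : 2 ≤ q)
    (hM : IsMulCost M) (hd : ∀ r c, inp r c < q) (h : Trace q n k z inp m i L D) (hm : m ≤ n)
    {s : State} (hs : LoopInv q inp n k z 0 0 ∅ 0 s) {Q : State → ℕ → Prop}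
    (hQ : ∀ s' t, LoopInv q inp n k z m i L D s' → t ≤ m * 5 + i * (rowCost M n k + 4) →
      Halts q M inp mainLoop s' fun s'' t' => Q s'' (t + t')) :
    Halts q M inp mainLoop s Q := by
  induction h generalizing Q with
  | zero => simpa using hQ s 0 hs (Nat.zero_le _)
  | @skip m i D L h hr ih =>
    refine ih (by omega) fun s1 t1 h1 ht1 => ?_
    refine halts_whileLt_of_lt (by rw [h1.idx_four, h1.idx_zero]; omega) ?_
    refine (halts_columnProg_of_not_endsAt h1 (by omega) hr).mono fun s2 t2 h2 => ?_
    refine (hQ s2 (t1 + t2 + 1) h2.1 (by have := h2.2; omega)).mono fun s3 t3 h3 => ?_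
    rwa [show t1 + (t2 + t3 + 1) = t1 + t2 + 1 + t3 by ring]
  | @row m i D r l L h hrk hr hu hl hlm hlL hik hD ih =>
    refine ih (by omega) fun s1 t1 h1 ht1 => ?_
    refine halts_whileLt_of_lt (by rw [h1.idx_four, h1.idx_zero]; omega) ?_
    refine (halts_columnProg_of_endsAt hq hM h1 (by omega) hik h.le h.posBelow hD (hd r) hrk hr hu
      hl).mono fun s2 t2 h2 => ?_
    refine (hQ s2 (t1 + t2 + 1) h2.1 ?_).mono fun s3 t3 h3 => ?_
    · have := h2.2
      rw [Nat.succ_mul, Nat.succ_mul]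
      omega
    · rwa [show t1 + (t2 + t3 + 1) = t1 + t2 + 1 + t3 by ring]

theorem halts_mainLoop {n k z i D : ℕ} {L : Finset ℕ} (hq : 2 ≤ q)
    (hM : IsMulCost M) (hd : ∀ r c, inp r c < q) (h : Trace q n k z inp n i L D)
    {s : State} (hs : LoopInv q inp n k z 0 0 ∅ 0 s) :
    Halts q M inp mainLoop s fun s' t =>
      s'.int 0 = D ∧ t ≤ n * 5 + i * (rowCost M n k + 4) + 1 :=
  halts_mainLoop_of_trace hq hM hd h le_rfl hs fun s' t h' ht =>
    halts_whileLt_of_not_lt (by rw [h'.idx_four, h'.idx_zero]; omega) ⟨h'.int_zero, by omega⟩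

/-! ### Initialization and the total cost. -/

/-- Prepare the registers for the main loop. -/
def setupProg : Prog :=
  inc 7 ;; areaProg ;; endsProg ;; store 3 6 7 ;; pack 3 3 7 ;; shl 2 3 3 ;; icopy 1 3

/-- The machine has no integer constants: `1` is packed from a single digit, which survives
reduction modulo `q` as `2 ≤ q`, and `q ^ (n * k)` is a shift of it. The initial inverse `1` belongs
to the empty product. -/
theorem halts_setupProg {n k z : ℕ} (hq : 2 ≤ q) (hn : 1 ≤ n) (hk : 1 ≤ k)
    (hne : ∀ r < k, ∃ c < n, inp r c ≠ z) :
    Halts q M inp setupProg (initial n k z) fun s' t =>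
      LoopInv q inp n k z 0 0 ∅ 0 s' ∧ t ≤ n * k * 19 + 8 := by
  rw [setupProg]
  simp only [halts_seq, halts_instr, eff, cost]
  refine (halts_areaProg (by simp [initial]) (by simp [initial])).mono fun s1 t1 h => ?_
  simp [initial] at h
  obtain ⟨a1, a2, a3, a4, -, a6⟩ := h
  have e0 : s1.idx 0 = n := by simp [a2]
  have e1 : s1.idx 1 = k := by simp [a2]
  have e2 : s1.idx 2 = z := by simp [a2]
  refine (halts_endsProg (by simp [a2]) (by simp [a3]) (by rwa [e0, e1, e2])).mono
    fun s2 t2 h => ?_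
  rw [e0, e1, e2] at h
  obtain ⟨b1, b2, b3, b4, -, b6⟩ := h
  have b2' : ∀ x, x ≠ 8 → x ≠ 3 → x < 20 → s2.idx x = if x = 7 then 1 else if x = 0 then n else
      if x = 1 then k else if x = 2 then z else 0 := fun x h1 h2 h3 => by
    rw [b2 x h1 (by omega), a2 x h2 (by omega)]
  have b2'' : s2.idx 3 = n * k := by rw [b2 3 (by omega) (by omega), a1]
  have hmod : 1 % q = 1 := Nat.mod_eq_of_lt (by omega)
  refine ⟨{ idx_zero := ?_, idx_one := ?_, idx_two := ?_, idx_three := ?_, idx_six := ?_,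
            idx_seven := ?_, int_two := ?_, int_three := ?_, int_four := ?_, table := ?_,
            idx_four := ?_, idx_five := ?_, marks := ?_, int_zero := ?_, int_one_lt := ?_,
            int_one_mul := ?_ }, ?_⟩
  · simp [b2']
  · simp [b2']
  · simp [b2']
  · simp [b2'']
  · simp [b2']
  · simp [b2']
  · simp [b2', b2'', hmod]
  · simp [b2', hmod]
  · simp [b4, a4]
  · simpa [IsEndTable] using b1
  · simp [b2']
  · simp [b2']
  · intro c
    simp [b3, a3]
  · simp [b4, a4]
  · simp [b2', hmod]
    exact Nat.one_lt_pow (Nat.mul_pos hn hk).ne' hq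
  · simp [b2', hmod]
    exact Nat.ModEq.refl _
  · simp [b2', b2'', hmod]
    have l1 : len q 1 = 1 := by simp [len]
    have h1 : k * (n * 3 + 4) ≤ n * k * 7 := by nlinarith [Nat.mul_le_mul_right k hn]
    have h2 : k * (n * 6 + 5) ≤ n * k * 11 := by nlinarith [Nat.mul_le_mul_right k hn]
    omega

/-- The decoding program. -/
def decodeProg : Prog := setupProg ;; mainLoop

theorem halts_decodeProg {n k z D : ℕ} {L : Finset ℕ} (hq : 2 ≤ q) (hn : 1 ≤ n) (hk : 1 ≤ k)
    (hM : IsMulCost M) (hd : ∀ r c, inp r c < q) (hne : ∀ r < k, ∃ c < n, inp r c ≠ z)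
    (h : Trace q n k z inp n k L D) :
    Halts q M inp decodeProg (initial n k z) fun s' t => s'.int 0 = D ∧
      t ≤ k * (9 * ∑ x ∈ Finset.range (k - 1), M (n * k / (x + 1)) + 123 * M (n * k)) := by
  rw [decodeProg, halts_seq]
  refine (halts_setupProg hq hn hk hne).mono fun s1 t1 h1 => ?_
  refine (halts_mainLoop hq hM hd h h1.1).mono fun s2 t2 h2 => ⟨h2.1, ?_⟩
  have g1 := h1.2
  have g2 := h2.2
  have hL1 : 1 ≤ n * k := Nat.mul_pos hn hk
  have hnk : n ≤ n * k := Nat.le_mul_of_pos_right _ hk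
  have hMm := hM.self_le hL1
  -- Here `90 = 2 + 44 + 44`, from `1 ≤ n * k ≤ M (n * k)`. In the same way the setup and the tests
  -- of the main loop give `33 = 19 + 8 + 5 + 1` below.
  have h3 : k * (rowCost M n k + 4) ≤
      k * (9 * ∑ x ∈ Finset.range (k - 1), M (n * k / (x + 1)) + 90 * M (n * k)) :=
    Nat.mul_le_mul_left _ (by rw [rowCost]; omega)
  have h4 : 33 * M (n * k) ≤ k * (33 * M (n * k)) := Nat.le_mul_of_pos_left _ hk
  have h5 : k * (9 * ∑ x ∈ Finset.range (k - 1), M (n * k / (x + 1)) + 123 * M (n * k)) =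
      k * (9 * ∑ x ∈ Finset.range (k - 1), M (n * k / (x + 1)) + 90 * M (n * k)) +
        k * (33 * M (n * k)) := by ring
  omega

end Programs

/-- Monotonicity of `M m / m` gives `M (a / x) ≤ M a / x`, rounding included, and the harmonic sum
is at most `1 + log k`. -/
theorem IsMulCost.sum_div_le {M : ℕ → ℕ} (hM : IsMulCost M) {a k : ℕ} (hk : k ≤ a) :
    ((∑ x ∈ Finset.range (k - 1), M (a / (x + 1)) : ℕ) : ℝ) ≤ M a * (1 + Real.log k) := by
  have h1 : ((∑ x ∈ Finset.range (k - 1), M (a / (x + 1)) : ℕ) : ℝ) ≤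
      ∑ x ∈ Finset.range k, (M a : ℝ) * ((x + 1 : ℕ) : ℝ)⁻¹ := by
    push_cast
    refine (Finset.sum_le_sum fun x hx => ?_).trans (Finset.sum_le_sum_of_subset_of_nonneg
      (Finset.range_subset_range.2 (Nat.sub_le k 1)) fun _ _ _ => by positivity)
    have hx' := Finset.mem_range.1 hx
    have hw : 1 ≤ a / (x + 1) := by
      rw [Nat.le_div_iff_mul_le (by omega), one_mul]; omega
    have h2 := hM.mul_le_mul hw (Nat.div_le_self a (x + 1))
    have h3 := Nat.div_mul_le_self a (x + 1)
    have h4 : M (a / (x + 1)) * (x + 1) ≤ M a := by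
      refine Nat.le_of_mul_le_mul_right (c := a) ?_ (by omega)
      calc M (a / (x + 1)) * (x + 1) * a = M (a / (x + 1)) * a * (x + 1) := by ring
        _ ≤ M a * (a / (x + 1)) * (x + 1) := Nat.mul_le_mul_right _ h2
        _ = M a * (a / (x + 1) * (x + 1)) := by ring
        _ ≤ M a * a := Nat.mul_le_mul_left _ h3
    rw [← div_eq_mul_inv, le_div_iff₀ (by positivity)]
    exact_mod_cast h4
  refine h1.trans ?_
  rw [← Finset.mul_sum]
  refine mul_le_mul_of_nonneg_left ?_ (Nat.cast_nonneg _)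
  have := harmonic_le_one_add_log k
  rw [harmonic] at this
  push_cast at this ⊢
  exact this

theorem exists_ne_zero_symbol {F : Type*} [Field F] {q : ℕ} (ρ : F ≃ Fin q) {n k : ℕ}
    {A : Matrix (Fin k) (Fin n) F} (hA : HasDistinctLeads A) :
    ∀ r < k, ∃ c < n, symbols ρ A r c ≠ ρ 0 := by
  intro r hr
  obtain ⟨c, hc⟩ := hA.exists_lead ⟨r, hr⟩
  exact ⟨c, c.2, (symbols_eq_zero_iff ρ A ⟨r, hr⟩ c).not.2 hc.2⟩

end GrassmannDecoding

theorem mainTheorem10 :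
    ∃ (P : Prog) (C : ℝ), ∀ (F : Type*) [Field F] [DecidableEq F] (q : ℕ) (ρ : F ≃ Fin q)
      (M : ℕ → ℕ), 1 ≤ M 1 → (∀ a b : ℕ, 1 ≤ a → a ≤ b → (M a : ℝ) / a ≤ (M b : ℝ) / b) →
      ∀ (n k : ℕ), 1 ≤ k → k ≤ n →
      ∀ A : Matrix (Fin k) (Fin n) F, A.IsReducedRowEchelon → (∀ i, A i ≠ 0) →
        decode ρ n k (canonical n k A) < gauss q n k ∧
        encode ρ n k (decode ρ n k (canonical n k A)) = Submodule.span F (Set.range A) ∧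
        ∃ (s : State) (t : ℕ),
          Exec q M (symbols ρ (canonical n k A)) P (initial n k (ρ 0)) s t ∧
          s.int 0 = decode ρ n k (canonical n k A) ∧
          (t : ℝ) ≤ C * (M (n * k) * (k * max 1 (Real.logb 2 k))) := by
  -- `141 = 9 * 2 + 123`, because `1 + log k` is at most twice `max 1 (logb 2 k)`.
  refine ⟨decodeProg, 141, fun F _ _ q ρ M hM1 hM2 n k hk hkn A hA hA0 => ?_⟩
  have hM : IsMulCost M := ⟨hM1, hM2⟩
  obtain ⟨h1, h2, -⟩ := canonical_spec (hA.isReduced hA0)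
  obtain ⟨h3, h4⟩ := decode_spec ρ h1
  refine ⟨h3, h4.trans h2, ?_⟩
  obtain ⟨L, hL⟩ := trace_of_isCanonical ρ h1
  obtain ⟨s, t, hst, hD, ht⟩ := halts_decodeProg (two_le_of_equiv ρ) (hk.trans hkn) hk hM
    (symbols_lt ρ _) (exists_ne_zero_symbol ρ h1.hasDistinctLeads) hL
  refine ⟨s, t, hst, hD, ?_⟩
  have hS := hM.sum_div_le (a := n * k) (k := k) (Nat.le_mul_of_pos_left _ (hk.trans hkn))
  set S := ∑ x ∈ Finset.range (k - 1), M (n * k / (x + 1))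
  have hk1 : (1 : ℝ) ≤ k := by exact_mod_cast hk
  have hlog : Real.log k ≤ max 1 (Real.logb 2 k) := by
    refine le_max_of_le_right ?_
    rw [Real.logb, le_div_iff₀ (Real.log_pos one_lt_two)]
    have := Real.log_two_lt_d9
    nlinarith [Real.log_nonneg hk1]
  have hone : (1 : ℝ) ≤ max 1 (Real.logb 2 k) := le_max_left _ _
  generalize max 1 (Real.logb 2 (k : ℝ)) = m at *
  have hMn : (0 : ℝ) ≤ M (n * k) := Nat.cast_nonneg _
  calc (t : ℝ) ≤ k * (9 * S + 123 * M (n * k)) := by exact_mod_cast ht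
    _ ≤ k * (9 * (M (n * k) * (m + m)) + 123 * (M (n * k) * m)) := by
        refine mul_le_mul_of_nonneg_left (add_le_add (mul_le_mul_of_nonneg_left ?_ (by norm_num))
          (mul_le_mul_of_nonneg_left ?_ (by norm_num))) (by linarith)
        · exact hS.trans (mul_le_mul_of_nonneg_left (by linarith) hMn)
        · exact le_mul_of_one_le_right hMn hone
    _ = 141 * (M (n * k) * (k * m)) := by ring
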